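/- Let $n_0,n_1,n_2\ge 1$ be integers and let $\theta_{n_0,n_1,n_2}$ be the theta graph: two vertices joined by three internally disjoint paths (strands) of lengths $n_0,n_1,n_2$. For $0\le i\le n_\alpha$, let $v_{\alpha,i}$ be the vertex at distance $i$ along strand $\alpha$ from a fixed one of the two trivalent vertices. Suppose that $(\theta_{n_0,n_1,n_2},v_{\alpha,i},v_{\beta,j})$ is evenly marked: $\alpha\ne\beta$, $0<i<n_\alpha$ and $i/n_\alpha=j/n_\beta$. Then $$k:=\frac{n_\alpha}{\gcd(n_\alpha,i)}=\frac{n_\beta}{\gcd(n_\beta,j)},$$ and, with $u=v_{\alpha,i}$ and $v=v_{\beta,j}$, $(\theta_{n_0,n_1,n_2},u,v)$ has $k$-general transmission. Moreover, the class $[u-v]$ has order exactly $k$ in the Jacobian and is non-recurrent, i.e. for every vertex $w$ there is at most one $m\in\{1,\dots,k-1\}$ such that $m(u-v)+w$ is linearly equivalent to an effective divisor. Here divisors are integer combinations of vertices, linear equivalence $\sim$ is generated by chip-firing moves, and $r$ is the Baker–Norine rank. A twice-marked graph $(G,u,v)$ of genus $g=|E(G)|-|V(G)|+1$ has $k$-general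 transmission ($k\geq 1$) if $ku\sim kv$ and every divisor $D$ satisfies the following. (1) $D$ is submodular: with $\Delta(D)=r(D)-r(D-u)-r(D-v)+r(D-u-v)$, one has $\Delta(D+au+bv)\ge 0$ for all $a,b\in\mathbb Z$. (2) $D$ has a transmission permutation, i.e. a bijection $\tau:\mathbb Z\to\mathbb Z$ (necessarily unique) such that, for all $a,b\in\mathbb Z$, $\Delta(D+au-bv)$ is $1$ if $\tau(b)=a$ and $0$ otherwise; and $\tau$ has at most $g$ $k$-inversions, that is, equivalence classes of pairs $(p,q)$ with $p<q$ and $\tau(p)>\tau(q)$ under simultaneous translation of both entries by multiples of $k$. -/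

import Mathlib

open scoped Graph

noncomputable section

namespace ChipFiring

/-! ### Divisors on finite multigraphs

Graphs are Mathlib's multigraphs `Graph α β`. The definitions make sense for any multigraph with
finitely many vertices; they are meant for finite connected graphs. -/

section Divisors

variable {α β : Type*} (G : Graph α β)

/-- The divisor group: integer combinations of the vertices. -/
abbrev Divisor : Type _ := V(G) → ℤ

/-- The genus `|E(G)| - |V(G)| + 1`. -/
def genus : ℤ := (E(G).ncard : ℤ) - (V(G).ncard : ℤ) + 1

/-- The number of edges joining `x` and `y`. -/
def edgeMult (x y : V(G)) : ℕ := {e : β | G.IsLink e x y}.ncard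

variable {G} in
open Classical in
/-- The divisor `x`, consisting of one chip on the vertex `x`. -/
def chip (x : V(G)) : Divisor G := fun y => if y = x then 1 else 0

variable [Fintype V(G)]

/-- The effect of firing each vertex `x` a total of `f x` times: every firing of `y` moves one
chip along each edge at `y` to the other end of that edge. -/
def fire : (V(G) → ℤ) →+ Divisor G where
  toFun f := fun x => ∑ y : V(G), (edgeMult G x y : ℤ) * (f y - f x)
  map_zero' := by
    funext x
    simp
  map_add' f h := by
    funext x
    simp only [Pi.add_apply]
    rw [← Finset.sum_add_distrib]
    exact Finset.sum_congr rfl fun y _ => by ring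

/-- The subgroup of principal divisors. -/
def principal : AddSubgroup (Divisor G) := (fire G).range

/-- The Picard group, i.e. divisors modulo linear equivalence. The Jacobian is its subgroup of
classes of degree `0`. -/
abbrev Pic : Type _ := Divisor G ⧸ principal G

variable {G}

/-- The class of a divisor in the Picard group. -/
def divClass (D : Divisor G) : Pic G := QuotientAddGroup.mk D

/-- Linear equivalence of divisors. -/
def LinEquiv (D D' : Divisor G) : Prop := divClass D = divClass D'

/-- The degree of a divisor. -/
def degree (D : Divisor G) : ℤ := ∑ x : V(G), D x

/-- `|D| ≠ ∅`: the divisor `D` is linearly equivalent to an effective one. -/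
def SystemNonempty (D : Divisor G) : Prop := ∃ F : Divisor G, 0 ≤ F ∧ LinEquiv D F

/-- The Baker–Norine rank: the largest `r ≥ -1` such that `|D - F| ≠ ∅` for every effective
divisor `F` of degree `r` (for `r = -1` there is no such `F`). -/
def rank (D : Divisor G) : ℤ :=
  sSup {r : ℤ | -1 ≤ r ∧ ∀ F : Divisor G, 0 ≤ F → degree F = r → SystemNonempty (D - F)}

/-- The class of a degree-`0` divisor `D` is non-recurrent if, with `k` the order of the class,
for every vertex `w` there is at most one `m ∈ {1, …, k - 1}` with `|m D + w| ≠ ∅`. -/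
def NonRecurrent (D : Divisor G) : Prop :=
  ∀ w : V(G),
    {m : ℕ | 1 ≤ m ∧ m < addOrderOf (divClass D) ∧ SystemNonempty (m • D + chip w)}.Subsingleton

/-! ### Twice-marked graphs -/

/-- `Δ(D) = r(D) - r(D - u) - r(D - v) + r(D - u - v)`. -/
def Delta (u v : V(G)) (D : Divisor G) : ℤ :=
  rank D - rank (D - chip u) - rank (D - chip v) + rank (D - chip u - chip v)

/-- `D` is submodular with respect to `u, v` if `Δ ≥ 0` on all its twists. -/
def Submodular (u v : V(G)) (D : Divisor G) : Prop :=
  ∀ a b : ℤ, 0 ≤ Delta u v (D + a • chip u + b • chip v)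

open Classical in
/-- `τ` is the transmission permutation of `D`. There is at most one such `τ`, since the condition
determines for which `a, b` one has `τ b = a`. -/
def IsTransmission (u v : V(G)) (D : Divisor G) (τ : Equiv.Perm ℤ) : Prop :=
  ∀ a b : ℤ, (if τ b = a then (1 : ℤ) else 0) = Delta u v (D + a • chip u - b • chip v)

end Divisors

/-! ### Inversions -/

/-- The inversions of a permutation of `ℤ`. -/
def Inversion (τ : Equiv.Perm ℤ) : Type := {p : ℤ × ℤ // p.1 < p.2 ∧ τ p.2 < τ p.1}

/-- `k`-equivalence of inversions: they differ by a translation by a multiple of `k`. -/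
def inversionSetoid (k : ℕ) (τ : Equiv.Perm ℤ) : Setoid (Inversion τ) where
  r p q := p.1.1 - q.1.1 = p.1.2 - q.1.2 ∧ (k : ℤ) ∣ p.1.1 - q.1.1
  iseqv :=
    { refl := fun p => by simp
      symm := fun {p q} h => ⟨by omega, by
        have := (dvd_neg (a := (k : ℤ))).mpr h.2
        rwa [neg_sub] at this⟩
      trans := fun {p q s} h h' => ⟨by omega, by
        have := dvd_add h.2 h'.2
        rwa [sub_add_sub_cancel] at this⟩ }

/-- `Inv_k(τ)`, the set of `k`-equivalence classes of inversions. -/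
def KInversions (k : ℕ) (τ : Equiv.Perm ℤ) : Type := Quotient (inversionSetoid k τ)

/-- `(G, u, v)` has `k`-general transmission: `k ≥ 1`, `k u ∼ k v`, and every divisor `D` is
submodular and has a transmission permutation with at most `g` (in particular, finitely many)
`k`-inversions, where `g` is the genus of `G`. -/
def HasGeneralTransmission {α β : Type*} (G : Graph α β) [Fintype V(G)] (u v : V(G)) (k : ℕ) :
    Prop :=
  0 < k ∧ LinEquiv (k • chip u) (k • chip v) ∧
    ∀ D : Divisor G, Submodular u v D ∧
      ∃ τ : Equiv.Perm ℤ, IsTransmission u v D τ ∧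
        Finite (KInversions k τ) ∧ (Nat.card (KInversions k τ) : ℤ) ≤ genus G

/-! ### Banana graphs and theta graphs -/

section Banana

variable {g : ℕ} (n : Fin (g + 1) → ℕ)

/-- The vertices of the banana graph: the two common ends of the strands (`inl false` and
`inl true`), and `n a - 1` interior vertices on the strand `a`. -/
abbrev BananaVertex : Type := Bool ⊕ (Σ a : Fin (g + 1), Fin (n a - 1))

/-- The edges of the banana graph: `n a` edges on the strand `a`. -/
abbrev BananaEdge : Type := Σ a : Fin (g + 1), Fin (n a)

/-- The vertex at distance `i` (for `0 ≤ i ≤ n a`) from the first common end along strand `a`. -/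
def bananaLabel (a : Fin (g + 1)) (i : ℕ) : BananaVertex n :=
  if i = 0 then Sum.inl false
  else if h : i - 1 < n a - 1 then Sum.inr ⟨a, ⟨i - 1, h⟩⟩
  else Sum.inl true

/-- The banana graph with strands of lengths `n 0, …, n g` (all positive): the `i`-th edge of the
strand `a` joins the vertices at distances `i` and `i + 1` along that strand. -/
def bananaGraph : Graph (BananaVertex n) (BananaEdge n) where
  vertexSet := Set.univ
  IsLink e x y := s(x, y) = s(bananaLabel n e.1 e.2, bananaLabel n e.1 (e.2 + 1))
  isLink_symm _ _ := ⟨fun x y h => (Sym2.eq_swap (a := y) (b := x)).trans h⟩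
  eq_or_eq_of_isLink_of_isLink e x y v w h h' := by
    have h2 : s(x, y) = s(v, w) := h.trans h'.symm
    rw [Sym2.eq_iff] at h2
    tauto
  left_mem_of_isLink _ _ _ _ := Set.mem_univ _

instance : Fintype V(bananaGraph n) := inferInstanceAs (Fintype (Set.univ : Set (BananaVertex n)))

/-- The vertex `v_{a,i}` of the banana graph, for `0 ≤ i ≤ n a`. -/
def bananaVertex (a : Fin (g + 1)) (i : ℕ) : V(bananaGraph n) := ⟨bananaLabel n a i, Set.mem_univ _⟩

end Banana

/-- The theta graph with strands of lengths `n 0, n 1, n 2`: the banana graph of genus `2`. -/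
abbrev thetaGraph (n : Fin 3 → ℕ) : Graph (BananaVertex (g := 2) n) (BananaEdge (g := 2) n) :=
  bananaGraph (g := 2) n

/-- The vertex `v_{a,i}` of the theta graph, for `0 ≤ i ≤ n a`. -/
abbrev thetaVertex (n : Fin 3 → ℕ) (a : Fin 3) (i : ℕ) : V(thetaGraph n) :=
  bananaVertex (g := 2) n a i

/-- The theta graph with marked vertices `v_{a,i}` and `v_{b,j}` is evenly marked. -/
structure EvenlyMarked (n : Fin 3 → ℕ) (a : Fin 3) (i : ℕ) (b : Fin 3) (j : ℕ) : Prop where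
  ratio_eq : (i : ℚ) / (n a : ℚ) = (j : ℚ) / (n b : ℚ)
  strand_ne : a ≠ b
  pos : 0 < i
  lt : i < n a

end ChipFiring

end

/-! The argument has two halves, joined by the structure `IsGenusTwoMarking`, a short list of facts
about classes of degree one and two.

The formal half. In genus 2 the rank depends only on the degree, on effectivity in degree 1 and on
being canonical in degree 2. So Δ vanishes outside degrees 0 to 4 and is explicit inside; it is
nonnegative because in degree 2 the divisors `D - u` and `D - v` are both effective only for `D ∼ K`
or `D ∼ u + v`. Along each row or column of twists, Δ is the increment of a function that rises from
0 to 1, so the matrix of values of Δ is a permutation matrix. The twist at `(τ p, p)` has degree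
between 0 and 4, an inversion `(p, q)` loses at least 2 of it, and starting degree 2 is excluded.
Degree 4 allows one residue of `p` modulo `k`, with at most two inversions; degree 3 allows at most
two residues, with one inversion each; the two degrees do not coexist (`not_three_of_four`). The
bound in degree 3 is the non-recurrence statement `dvd_of_three`.

The theta graph half. A class is its degree together with a vector in ℤ³ modulo the lattice
generated by `(1,1,1)` and the `n a ε_a - n b ε_b` (`divClass_eq_iff_coord`). Effective classes of
degree 1 are those of vectors on a coordinate axis with entry in `[0, n a]`. Write `n a = k A`, `n b
= k B`, `u = t A ε_a`, `v = t B ε_b` with `t` prime to `k`. A sign analysis (`exists_of_coordEquiv`)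
shows that if two such vectors satisfy `y - x ∼ m (u - v)` with `k ∤ m`, then `y - x = (A M, -B M,
0)` on the strands `a, b, c`, where `M ≡ m t` modulo `k` and `0 < |M| < k`. As `x` and `y` are each
supported on one strand, `x` alone determines `M`, hence `m` modulo `k`: this is non-recurrence. The
case `m = 1` yields the dichotomy between `K` and `u + v`. -/

namespace ChipFiring

/-! ### Linear equivalence, effectivity and rank -/

section General

variable {α β : Type*} {G : Graph α β}

theorem edgeMult_comm (x y : V(G)) : edgeMult G x y = edgeMult G y x := by
  unfold edgeMult
  congr 1
  ext e
  exact Graph.isLink_comm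

theorem chip_nonneg (x : V(G)) : 0 ≤ chip x := by
  intro y
  unfold chip
  split_ifs <;> simp

theorem chip_le_of_pos {F : Divisor G} (hF : 0 ≤ F) {x : V(G)} (hx : 0 < F x) : 0 ≤ F - chip x := by
  intro y
  have := hF y
  simp only [Pi.zero_apply] at this
  simp only [Pi.zero_apply, Pi.sub_apply, chip]
  split_ifs with h
  · subst h; omega
  · omega

variable [Fintype V(G)]

theorem degree_fire (f : V(G) → ℤ) : degree (fire G f) = 0 := by
  have h : degree (fire G f) = -degree (fire G f) := by
    calc degree (fire G f) = ∑ x, ∑ y, (edgeMult G x y : ℤ) * (f y - f x) := rfl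
      _ = ∑ y, ∑ x, (edgeMult G x y : ℤ) * (f y - f x) := Finset.sum_comm
      _ = ∑ y, ∑ x, -((edgeMult G y x : ℤ) * (f x - f y)) := by
        refine Finset.sum_congr rfl fun y _ => Finset.sum_congr rfl fun x _ => ?_
        rw [edgeMult_comm]; ring
      _ = -degree (fire G f) := by
        simp only [Finset.sum_neg_distrib]; rfl
  omega

@[simp] theorem degree_add (D E : Divisor G) : degree (D + E) = degree D + degree E :=
  Finset.sum_add_distrib

@[simp] theorem degree_sub (D E : Divisor G) : degree (D - E) = degree D - degree E :=
  Finset.sum_sub_distrib ..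

@[simp] theorem degree_zero : degree (0 : Divisor G) = 0 := Finset.sum_const_zero

@[simp] theorem degree_zsmul (m : ℤ) (D : Divisor G) : degree (m • D) = m * degree D :=
  (Finset.mul_sum ..).symm

@[simp] theorem degree_chip (x : V(G)) : degree (chip x) = 1 := by
  classical
  unfold degree chip
  rw [Finset.sum_ite_eq' Finset.univ x (fun _ => (1 : ℤ))]
  simp

@[simp] theorem divClass_add (D E : Divisor G) :
    divClass (D + E) = divClass D + divClass E := rfl

@[simp] theorem divClass_sub (D E : Divisor G) :
    divClass (D - E) = divClass D - divClass E := rfl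

@[simp] theorem divClass_zero : divClass (0 : Divisor G) = 0 := rfl

@[simp] theorem divClass_zsmul (m : ℤ) (D : Divisor G) :
    divClass (m • D) = m • divClass D := rfl

theorem divClass_fire (f : V(G) → ℤ) : divClass (fire G f) = 0 :=
  (QuotientAddGroup.eq_zero_iff _).2 ⟨f, rfl⟩

theorem divClass_eq_iff {D E : Divisor G} :
    divClass D = divClass E ↔ ∃ f, fire G f = E - D := by
  unfold divClass
  rw [QuotientAddGroup.eq, neg_add_eq_sub]
  rfl

theorem LinEquiv.degree_eq {D E : Divisor G} (h : LinEquiv D E) : degree D = degree E := by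
  obtain ⟨f, hf⟩ := divClass_eq_iff.1 h
  have := degree_fire f
  rw [hf, degree_sub] at this
  omega

theorem degree_nonneg {F : Divisor G} (h : 0 ≤ F) : 0 ≤ degree F :=
  Finset.sum_nonneg fun x _ => h x

theorem exists_pos_of_degree_pos {F : Divisor G} (h : 0 < degree F) : ∃ x, 0 < F x := by
  by_contra! hc
  exact absurd (Finset.sum_nonpos fun x _ => hc x) (not_le.2 h)

theorem eq_zero_of_degree_eq_zero {F : Divisor G} (hF : 0 ≤ F) (h : degree F = 0) : F = 0 := by
  funext x
  exact (Finset.sum_eq_zero_iff_of_nonneg fun x _ => hF x).1 h x (Finset.mem_univ x)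

theorem eq_chip_of_degree_eq_one {F : Divisor G} (hF : 0 ≤ F) (h : degree F = 1) :
    ∃ x, F = chip x := by
  obtain ⟨x, hx⟩ := exists_pos_of_degree_pos (F := F) (by omega)
  exact ⟨x, sub_eq_zero.1 (eq_zero_of_degree_eq_zero (chip_le_of_pos hF hx) (by simp [h]))⟩

theorem SystemNonempty.of_divClass_eq {D E : Divisor G} (h : SystemNonempty D)
    (hDE : divClass D = divClass E) : SystemNonempty E := by
  obtain ⟨F, hF, h⟩ := h
  exact ⟨F, hF, hDE.symm.trans h⟩

theorem systemNonempty_congr {D E : Divisor G} (h : divClass D = divClass E) :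
    SystemNonempty D ↔ SystemNonempty E :=
  ⟨fun hD => hD.of_divClass_eq h, fun hE => hE.of_divClass_eq h.symm⟩

theorem systemNonempty_of_nonneg {D : Divisor G} (h : 0 ≤ D) : SystemNonempty D := ⟨D, h, rfl⟩

theorem SystemNonempty.add {D E : Divisor G} (h : SystemNonempty D) (hE : SystemNonempty E) :
    SystemNonempty (D + E) := by
  obtain ⟨F, hF, h⟩ := h
  obtain ⟨F', hF', h'⟩ := hE
  refine ⟨F + F', add_nonneg hF hF', ?_⟩
  unfold LinEquiv at *
  rw [divClass_add, divClass_add, h, h']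

theorem SystemNonempty.degree_nonneg {D : Divisor G} (h : SystemNonempty D) : 0 ≤ degree D := by
  obtain ⟨F, hF, h⟩ := h
  rw [h.degree_eq]
  exact ChipFiring.degree_nonneg hF

theorem systemNonempty_iff_of_degree_eq_zero {D : Divisor G} (h : degree D = 0) :
    SystemNonempty D ↔ divClass D = 0 := by
  constructor
  · rintro ⟨F, hF, hD⟩
    have := eq_zero_of_degree_eq_zero hF (hD.degree_eq.symm.trans h)
    rw [hD, this, divClass_zero]
  · intro hD
    exact ⟨0, le_rfl, hD⟩

theorem systemNonempty_iff_of_degree_eq_one {D : Divisor G} (h : degree D = 1) :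
    SystemNonempty D ↔ ∃ w, divClass D = divClass (chip w) := by
  constructor
  · rintro ⟨F, hF, hD⟩
    obtain ⟨w, rfl⟩ := eq_chip_of_degree_eq_one hF (hD.degree_eq.symm.trans h)
    exact ⟨w, hD⟩
  · rintro ⟨w, hw⟩
    exact ⟨chip w, chip_nonneg w, hw⟩

/-- The condition `r(D) ≥ r` for `r ≥ 0`. -/
def RankAtLeast (D : Divisor G) (r : ℤ) : Prop :=
  ∀ F : Divisor G, 0 ≤ F → degree F = r → SystemNonempty (D - F)

theorem RankAtLeast.le_degree [Nonempty V(G)] {D : Divisor G} {r : ℤ} (hr : 0 ≤ r)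
    (h : RankAtLeast D r) : r ≤ degree D := by
  obtain ⟨x⟩ := ‹Nonempty V(G)›
  have := (h (r • chip x) (zsmul_nonneg (chip_nonneg x) hr)
    (by simp [-zsmul_eq_mul])).degree_nonneg
  simpa [-zsmul_eq_mul] using this

/-- Pad `F` with `s - r` further chips at any vertex and give them back afterwards; adding chips
preserves effectivity. -/
theorem RankAtLeast.mono [Nonempty V(G)] {D : Divisor G} {r s : ℤ} (hrs : r ≤ s)
    (h : RankAtLeast D s) : RankAtLeast D r := by
  intro F hF hd
  obtain ⟨x⟩ := ‹Nonempty V(G)›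
  have hx : 0 ≤ (s - r) • chip x := zsmul_nonneg (chip_nonneg x) (by omega)
  have := (h (F + (s - r) • chip x) (add_nonneg hF hx) (by simp [hd, -zsmul_eq_mul])).add
    (systemNonempty_of_nonneg hx)
  convert this using 1
  abel

/-- By monotonicity of `RankAtLeast`, one failure at `r + 1` makes `r` the greatest element of the
set whose supremum defines `rank`. -/
theorem rank_eq_of [Nonempty V(G)] {D : Divisor G} {r : ℤ} (hr : -1 ≤ r) (h : RankAtLeast D r)
    (h' : ¬ RankAtLeast D (r + 1)) : rank D = r := by
  have : IsGreatest {r : ℤ | -1 ≤ r ∧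
      ∀ F : Divisor G, 0 ≤ F → degree F = r → SystemNonempty (D - F)} r := by
    refine ⟨⟨hr, h⟩, fun s hs => ?_⟩
    by_contra hc
    exact h' (RankAtLeast.mono (by omega) hs.2)
  exact this.csSup_eq

theorem rankAtLeast_neg_one (D : Divisor G) : RankAtLeast D (-1) := fun F hF h => by
  have := degree_nonneg hF
  omega

theorem rankAtLeast_zero_iff {D : Divisor G} : RankAtLeast D 0 ↔ SystemNonempty D := by
  constructor
  · intro h
    simpa using h 0 le_rfl (by simp)
  · intro h F hF hd
    rw [eq_zero_of_degree_eq_zero hF hd, sub_zero]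
    exact h

theorem rankAtLeast_succ_iff {D : Divisor G} {r : ℤ} (hr : 0 ≤ r) :
    RankAtLeast D (r + 1) ↔ ∀ w, RankAtLeast (D - chip w) r := by
  constructor
  · intro h w F hF hd
    rw [sub_sub]
    exact h _ (add_nonneg (chip_nonneg w) hF) (by simp [hd, add_comm])
  · intro h F hF hd
    obtain ⟨w, hw⟩ := exists_pos_of_degree_pos (F := F) (by omega)
    have := h w (F - chip w) (chip_le_of_pos hF hw) (by simp [hd])
    rwa [sub_sub_sub_cancel_right] at this

theorem rank_eq_neg_one [Nonempty V(G)] {D : Divisor G} (h : ¬ SystemNonempty D) : rank D = -1 :=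
  rank_eq_of le_rfl (rankAtLeast_neg_one D) (by simpa [rankAtLeast_zero_iff] using h)

end General

/-! ### Ranks and Δ in genus two -/

section GenusTwo

variable {α β : Type*} {G : Graph α β} [Fintype V(G)]

theorem rank_of_degree_neg [Nonempty V(G)] {D : Divisor G} (hD : degree D < 0) : rank D = -1 :=
  rank_eq_neg_one fun hc => absurd hc.degree_nonneg (not_le.2 hD)

open Classical in
theorem rank_of_degree_zero [Nonempty V(G)] {D : Divisor G} (hD : degree D = 0) :
    rank D = (if divClass D = 0 then 1 else 0) - 1 := by
  have hiff := systemNonempty_iff_of_degree_eq_zero hD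
  split_ifs with hc
  · refine rank_eq_of (by norm_num) ?_ fun hr => ?_
    · simpa [rankAtLeast_zero_iff, hiff] using hc
    · have := hr.le_degree (by norm_num)
      omega
  · simpa using rank_eq_neg_one (hiff.not.2 hc)

theorem delta_of_degree_neg (u v : V(G)) {D : Divisor G} (hD : degree D < 0) :
    Delta u v D = 0 := by
  have : Nonempty V(G) := ⟨u⟩
  unfold Delta
  rw [rank_of_degree_neg hD, rank_of_degree_neg (by simp; omega),
    rank_of_degree_neg (by simp; omega), rank_of_degree_neg (by simp; omega)]
  norm_num

open Classical in
theorem delta_of_degree_zero (u v : V(G)) {D : Divisor G} (hD : degree D = 0) :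
    Delta u v D = if divClass D = 0 then 1 else 0 := by
  have : Nonempty V(G) := ⟨u⟩
  unfold Delta
  rw [rank_of_degree_zero hD, rank_of_degree_neg (by simp; omega),
    rank_of_degree_neg (by simp; omega), rank_of_degree_neg (by simp; omega)]
  ring

/-- The properties of a twice-marked graph of genus `2`, with canonical class `K`, from which
`k`-general transmission is deduced. -/
structure IsGenusTwoMarking (u v : V(G)) (K : Divisor G) (k : ℕ) : Prop where
  degree_canonical : degree K = 2
  nonempty_of_degree_two : ∀ D : Divisor G, degree D = 2 → SystemNonempty D
  nonempty_canonical_sub : ∀ w, SystemNonempty (K - chip w)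
  eq_canonical : ∀ D : Divisor G, degree D = 2 → (∀ w, SystemNonempty (D - chip w)) →
    divClass D = divClass K
  eq_canonical_or : ∀ D : Divisor G, degree D = 2 → SystemNonempty (D - chip u) →
    SystemNonempty (D - chip v) →
    divClass D = divClass K ∨ divClass D = divClass (chip u) + divClass (chip v)
  add_ne_canonical : divClass (chip u) + divClass (chip v) ≠ divClass K
  two_le : 2 ≤ k
  zsmul_eq_zero_iff : ∀ m : ℤ, m • (divClass (chip u) - divClass (chip v)) = 0 ↔ (k : ℤ) ∣ m
  dvd_of_three : ∀ D : Divisor G, degree D = 1 → ∀ m m' : ℤ, SystemNonempty D →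
    SystemNonempty (D + m • (chip u - chip v)) → SystemNonempty (D + m' • (chip u - chip v)) →
    (k : ℤ) ∣ m ∨ (k : ℤ) ∣ m' ∨ (k : ℤ) ∣ m - m'

namespace IsGenusTwoMarking

variable {u v : V(G)} {K : Divisor G} {k : ℕ}

theorem class_ne (h : IsGenusTwoMarking u v K k) : divClass (chip u) ≠ divClass (chip v) := by
  intro he
  have h1 := (h.zsmul_eq_zero_iff 1).1 (by simp [he])
  have h2 := h.two_le
  have := Int.le_of_dvd one_pos h1
  omega

open Classical in
theorem rank_of_degree_one (h : IsGenusTwoMarking u v K k) {D : Divisor G} (hD : degree D = 1) :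
    rank D = (if SystemNonempty D then 1 else 0) - 1 := by
  have : Nonempty V(G) := ⟨u⟩
  split_ifs with hc
  · refine rank_eq_of (by norm_num) (by simpa [rankAtLeast_zero_iff] using hc) fun hr => ?_
    have hw : ∀ w, divClass D = divClass (chip w) := fun w => by
      have := (rankAtLeast_succ_iff (r := 0) le_rfl).1 (by simpa using hr) w
      rw [rankAtLeast_zero_iff, systemNonempty_iff_of_degree_eq_zero (by simp [hD])] at this
      exact sub_eq_zero.1 this
    exact h.class_ne ((hw u).symm.trans (hw v))
  · simpa using rank_eq_neg_one hc

/-- Otherwise every `D - w` would have rank at least 1 in degree 2, hence be canonical, and all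
vertices would be equivalent, contrary to `u ≁ v`. This stands in for the upper bound of
Riemann–Roch. -/
theorem not_rankAtLeast_two (h : IsGenusTwoMarking u v K k) {D : Divisor G} (hD : degree D = 3) :
    ¬ RankAtLeast D 2 := by
  intro hr
  have hw : ∀ w, divClass D - divClass (chip w) = divClass K := fun w => by
    refine h.eq_canonical (D - chip w) (by simp [hD]) fun w' => ?_
    have := (rankAtLeast_succ_iff (r := 1) zero_le_one).1 (by simpa using hr) w
    have := (rankAtLeast_succ_iff (r := 0) le_rfl).1 (by simpa using this) w'
    rwa [rankAtLeast_zero_iff] at this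
  exact h.class_ne (sub_right_injective ((hw u).trans (hw v).symm))

open Classical in
theorem rank_of_degree_two (h : IsGenusTwoMarking u v K k) {D : Divisor G} (hD : degree D = 2) :
    rank D = if divClass D = divClass K then 1 else 0 := by
  have : Nonempty V(G) := ⟨u⟩
  have key : RankAtLeast D 1 ↔ ∀ w, SystemNonempty (D - chip w) := by
    rw [← zero_add (1 : ℤ), rankAtLeast_succ_iff le_rfl]
    simp only [rankAtLeast_zero_iff]
  split_ifs with hc
  · refine rank_eq_of (by norm_num) (key.2 fun w => ?_) fun hr => ?_
    · exact (h.nonempty_canonical_sub w).of_divClass_eq (by simp [hc])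
    · have : RankAtLeast (D + chip u) 2 := by
        intro F hF hd
        have := (hr F hF (by simpa using hd)).add (systemNonempty_of_nonneg (chip_nonneg u))
        convert this using 1
        abel
      exact h.not_rankAtLeast_two (by simp [hD]) this
  · refine rank_eq_of (by norm_num) (rankAtLeast_zero_iff.2 (h.nonempty_of_degree_two D hD))
      fun hr => hc (h.eq_canonical D hD (key.1 (by simpa using hr)))

/-- Removing `degree D - 2` chips leaves degree 2, which is always effective. A larger rank would,
after removing copies of `u` down to degree 3, contradict `not_rankAtLeast_two`. -/
theorem rank_of_three_le_degree (h : IsGenusTwoMarking u v K k) {D : Divisor G}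
    (hD : 3 ≤ degree D) : rank D = degree D - 2 := by
  have : Nonempty V(G) := ⟨u⟩
  refine rank_eq_of (by omega) (fun F hF hd => h.nonempty_of_degree_two _ (by simp [hd]))
    fun hr => ?_
  refine h.not_rankAtLeast_two (D := D - (degree D - 3) • chip u)
    (by simp [-zsmul_eq_mul]) fun F hF hd => ?_
  rw [sub_sub]
  exact hr _ (add_nonneg (zsmul_nonneg (chip_nonneg u) (by omega)) hF)
    (by rw [degree_add, degree_zsmul, degree_chip, hd]; ring)

open Classical in
theorem delta_of_degree_one (h : IsGenusTwoMarking u v K k) {D : Divisor G} (hD : degree D = 1) :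
    Delta u v D = (if SystemNonempty D then 1 else 0) -
      (if divClass D = divClass (chip u) then 1 else 0) -
      (if divClass D = divClass (chip v) then 1 else 0) := by
  have : Nonempty V(G) := ⟨u⟩
  unfold Delta
  rw [h.rank_of_degree_one hD, rank_of_degree_zero (by simp; omega),
    rank_of_degree_zero (by simp; omega), rank_of_degree_neg (by simp; omega)]
  simp only [divClass_sub, sub_eq_zero]
  ring

open Classical in
theorem delta_of_degree_two (h : IsGenusTwoMarking u v K k) {D : Divisor G} (hD : degree D = 2) :
    Delta u v D = 1 + (if divClass D = divClass K then 1 else 0) -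
      (if SystemNonempty (D - chip u) then 1 else 0) -
      (if SystemNonempty (D - chip v) then 1 else 0) +
      (if divClass D = divClass (chip u) + divClass (chip v) then 1 else 0) := by
  have : Nonempty V(G) := ⟨u⟩
  unfold Delta
  rw [h.rank_of_degree_two hD, h.rank_of_degree_one (by simp; omega),
    h.rank_of_degree_one (by simp; omega), rank_of_degree_zero (by simp; omega)]
  simp only [divClass_sub, sub_eq_iff_eq_add, add_comm (divClass (chip v)), zero_add]
  ring

open Classical in
theorem delta_of_degree_three (h : IsGenusTwoMarking u v K k) {D : Divisor G} (hD : degree D = 3) :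
    Delta u v D = (if SystemNonempty (D - chip u - chip v) then 1 else 0) -
      (if divClass D = divClass K + divClass (chip u) then 1 else 0) -
      (if divClass D = divClass K + divClass (chip v) then 1 else 0) := by
  unfold Delta
  rw [h.rank_of_three_le_degree hD.ge, h.rank_of_degree_two (by simp; omega),
    h.rank_of_degree_two (by simp; omega), h.rank_of_degree_one (by simp; omega), hD]
  simp only [divClass_sub, sub_eq_iff_eq_add]
  ring

open Classical in
theorem delta_of_degree_four (h : IsGenusTwoMarking u v K k) {D : Divisor G} (hD : degree D = 4) :
    Delta u v D =
      if divClass D = divClass K + divClass (chip u) + divClass (chip v) then 1 else 0 := by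
  unfold Delta
  rw [h.rank_of_three_le_degree (by omega), h.rank_of_three_le_degree (by simp; omega),
    h.rank_of_three_le_degree (by simp; omega), h.rank_of_degree_two (by simp; omega)]
  simp only [divClass_sub, sub_eq_iff_eq_add, degree_sub, degree_chip, hD,
    add_right_comm (divClass K)]
  ring

theorem delta_of_five_le_degree (h : IsGenusTwoMarking u v K k) {D : Divisor G}
    (hD : 5 ≤ degree D) : Delta u v D = 0 := by
  unfold Delta
  rw [h.rank_of_three_le_degree (by omega), h.rank_of_three_le_degree (by simp; omega),
    h.rank_of_three_le_degree (by simp; omega), h.rank_of_three_le_degree (by simp; omega)]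
  simp only [degree_sub, degree_chip]
  ring

/-- In degrees 1 and 3 the two subtracted indicators exclude each other, since `u ≁ v`, and each
forces the positive one. In degree 2, `eq_canonical_or` supplies a compensating term when both are
1. -/
theorem delta_nonneg (h : IsGenusTwoMarking u v K k) (D : Divisor G) : 0 ≤ Delta u v D := by
  have hne := h.class_ne
  obtain hD | hD | hD | hD | hD | hD | hD : degree D < 0 ∨ degree D = 0 ∨ degree D = 1 ∨
    degree D = 2 ∨ degree D = 3 ∨ degree D = 4 ∨ 5 ≤ degree D := by omega
  · exact (delta_of_degree_neg u v hD).ge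
  · rw [delta_of_degree_zero u v hD]
    split_ifs <;> simp
  · rw [h.delta_of_degree_one hD]
    have hu : divClass D = divClass (chip u) → SystemNonempty D := fun he =>
      (systemNonempty_iff_of_degree_eq_one hD).2 ⟨u, he⟩
    have hv : divClass D = divClass (chip v) → SystemNonempty D := fun he =>
      (systemNonempty_iff_of_degree_eq_one hD).2 ⟨v, he⟩
    split_ifs <;> simp_all
  · rw [h.delta_of_degree_two hD]
    have := h.eq_canonical_or D hD
    split_ifs <;> simp_all
  · rw [h.delta_of_degree_three hD]
    have hu : divClass D = divClass K + divClass (chip u) →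
        SystemNonempty (D - chip u - chip v) := fun he =>
      (h.nonempty_canonical_sub v).of_divClass_eq (by simp [he])
    have hv : divClass D = divClass K + divClass (chip v) →
        SystemNonempty (D - chip u - chip v) := fun he =>
      (h.nonempty_canonical_sub u).of_divClass_eq (by simp only [divClass_sub, he]; abel)
    split_ifs <;> simp_all
  · rw [h.delta_of_degree_four hD]
    split_ifs <;> simp
  · exact (h.delta_of_five_le_degree hD).ge

end IsGenusTwoMarking
end GenusTwo
-- Existence of the transmission permutation
/-- A monotone integer sequence that is eventually `0` to the left and eventually `1` to the right
jumps exactly once. -/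
theorem exists_jump {g : ℤ → ℤ} (hg : ∀ a, 0 ≤ g a - g (a - 1)) {A B : ℤ}
    (hA : ∀ a ≤ A, g a = 0) (hB : ∀ a ≥ B, g a = 1) :
    ∃ t, ∀ a, (if t = a then (1 : ℤ) else 0) = g a - g (a - 1) := by
  have hm : Monotone g := monotone_int_of_le_succ fun n => by
    have := hg (n + 1)
    rw [add_sub_cancel_right] at this
    omega
  obtain ⟨t, ht, ht'⟩ := Int.exists_least_of_bdd (P := fun a => g a = 1)
    ⟨A, fun z hz => by
      by_contra! hc
      have := hA z hc.le
      omega⟩ ⟨B, hB B le_rfl⟩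
  have h1 : ∀ a, t ≤ a → g a = 1 := fun a ha => by
    have := hm ha
    have := hm (le_max_left a B)
    have := hB (max a B) (le_max_right a B)
    omega
  have h0 : ∀ a, a < t → g a = 0 := fun a ha => by
    have := hm (min_le_left a A)
    have := hA (min a A) (min_le_right a A)
    have := hm ha.le
    have : g a ≠ 1 := fun hc => absurd (ht' a hc) (not_le.2 ha)
    omega
  refine ⟨t, fun a => ?_⟩
  split_ifs with hta
  · rw [h1 a hta.le, h0 (a - 1) (by omega)]; norm_num
  · rcases lt_or_gt_of_ne hta with hlt | hgt
    · rw [h1 a hlt.le, h1 (a - 1) (by omega)]; norm_num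
    · rw [h0 a hgt, h0 (a - 1) (by omega)]; norm_num

/-- A matrix with exactly one 1 in each row and each column, and zeros elsewhere, is a permutation
matrix; the row and column choices are mutually inverse. -/
theorem exists_perm_of_rows_columns {δ : ℤ → ℤ → ℤ}
    (hr : ∀ b, ∃ t, ∀ a, (if t = a then (1 : ℤ) else 0) = δ a b)
    (hc : ∀ a, ∃ t, ∀ b, (if t = b then (1 : ℤ) else 0) = δ a b) :
    ∃ τ : Equiv.Perm ℤ, ∀ a b, (if τ b = a then (1 : ℤ) else 0) = δ a b := by
  choose T hT using hr
  choose S hS using hc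
  have key : ∀ a b, T b = a ↔ S a = b := fun a b => by
    have h := (hT b a).trans (hS a b).symm
    split_ifs at h <;> simp_all
  exact ⟨⟨T, S, fun b => (key _ _).1 rfl, fun a => (key _ _).2 rfl⟩, fun a b => hT b a⟩

section GenusTwo

variable {α β : Type*} {G : Graph α β} [Fintype V(G)]

theorem delta_comm (u v : V(G)) (D : Divisor G) : Delta u v D = Delta v u D := by
  unfold Delta
  rw [sub_right_comm D]
  ring

namespace IsGenusTwoMarking

variable {u v : V(G)} {K : Divisor G} {k : ℕ}

theorem exists_jump_twist (h : IsGenusTwoMarking u v K k) {x y : V(G)}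
    (hxy : ∀ D, 0 ≤ Delta x y D) (D : Divisor G) :
    ∃ t : ℤ, ∀ a : ℤ, (if t = a then (1 : ℤ) else 0) = Delta x y (D + a • chip x) := by
  have : Nonempty V(G) := ⟨u⟩
  have hstep : ∀ a : ℤ, Delta x y (D + a • chip x) =
      (rank (D + a • chip x) - rank (D + a • chip x - chip y)) -
      (rank (D + (a - 1) • chip x) - rank (D + (a - 1) • chip x - chip y)) := fun a => by
    have : D + (a - 1) • chip x = D + a • chip x - chip x := by
      rw [sub_smul, one_smul, add_sub_assoc]
    unfold Delta
    rw [this]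
    ring
  simp only [hstep]
  -- Below degree 0 both ranks are -1. From degree 4 on both divisors have degree at least 3, where
  -- the rank is the degree minus 2.
  refine exists_jump (g := fun a => rank (D + a • chip x) - rank (D + a • chip x - chip y))
    (fun a => hstep a ▸ hxy _) (A := -degree D - 1) (B := 4 - degree D) (fun a ha => ?_)
    (fun a ha => ?_)
  · have hd : degree (D + a • chip x) = degree D + a := by
      rw [degree_add, degree_zsmul, degree_chip, mul_one]
    rw [rank_of_degree_neg (by omega),
      rank_of_degree_neg (by rw [degree_sub, degree_chip]; omega)]
    norm_num
  · have hd : degree (D + a • chip x) = degree D + a := by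
      rw [degree_add, degree_zsmul, degree_chip, mul_one]
    rw [h.rank_of_three_le_degree (by omega),
      h.rank_of_three_le_degree (by rw [degree_sub, degree_chip]; omega), degree_sub, degree_chip]
    ring

theorem exists_isTransmission (h : IsGenusTwoMarking u v K k) (D : Divisor G) :
    ∃ τ, IsTransmission u v D τ := by
  have := exists_perm_of_rows_columns (δ := fun a b => Delta u v (D + a • chip u - b • chip v))
    (fun b => by
      obtain ⟨t, ht⟩ := h.exists_jump_twist h.delta_nonneg (D - b • chip v)
      refine ⟨t, fun a => ?_⟩
      rw [ht, sub_add_eq_add_sub])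
    (fun a => by
      obtain ⟨t, ht⟩ := h.exists_jump_twist (x := v) (y := u)
        (fun E => delta_comm u v E ▸ h.delta_nonneg E) (D + a • chip u)
      -- Twists by `v` enter with a minus sign, so the position of the jump is negated.
      refine ⟨-t, fun b => ?_⟩
      have := ht (-b)
      rw [neg_smul, ← sub_eq_add_neg, ← delta_comm] at this
      rw [← this]
      simp only [neg_eq_iff_eq_neg])
  obtain ⟨τ, hτ⟩ := this
  exact ⟨τ, fun a b => by rw [← hτ]⟩

end IsGenusTwoMarking

end GenusTwo

/-! ### Counting inversions modulo `k` -/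

theorem finite_and_card_le_two {γ : Type*} (h : ∀ x y z : γ, x = y ∨ x = z ∨ y = z) :
    Finite γ ∧ Nat.card γ ≤ 2 := by
  rcases isEmpty_or_nonempty γ with hγ | ⟨⟨x⟩⟩
  · exact ⟨inferInstance, by simp⟩
  · have : ∃ y, ∀ z, z = x ∨ z = y := by
      by_cases hc : ∃ y, y ≠ x
      · obtain ⟨y, hy⟩ := hc
        refine ⟨y, fun z => ?_⟩
        rcases h x y z with he | he | he
        · exact absurd he.symm hy
        · exact Or.inl he.symm
        · exact Or.inr he.symm
      · push Not at hc
        exact ⟨x, fun z => Or.inl (hc z)⟩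
    obtain ⟨y, hy⟩ := this
    have hs : Function.Surjective (fun b : Bool => if b then x else y) := fun z => by
      rcases hy z with rfl | rfl
      · exact ⟨true, rfl⟩
      · exact ⟨false, rfl⟩
    exact ⟨Finite.of_surjective _ hs, by simpa using Nat.card_le_card_of_surjective _ hs⟩

section GenusTwo

variable {α β : Type*} {G : Graph α β} [Fintype V(G)]

theorem rank_congr {D E : Divisor G} (h : divClass D = divClass E) : rank D = rank E := by
  unfold rank
  have : ∀ F, SystemNonempty (D - F) ↔ SystemNonempty (E - F) := fun F =>
    systemNonempty_congr (by simp [h])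
  simp only [this]

theorem delta_congr (u v : V(G)) {D E : Divisor G} (h : divClass D = divClass E) :
    Delta u v D = Delta u v E := by
  unfold Delta
  rw [rank_congr h, rank_congr (D := D - chip u) (E := E - chip u) (by simp [h]),
    rank_congr (D := D - chip v) (E := E - chip v) (by simp [h]),
    rank_congr (D := D - chip u - chip v) (E := E - chip u - chip v) (by simp [h])]

/-- The twist `D + τ(p) u - p v`. -/
noncomputable def twistAt (u v : V(G)) (D : Divisor G) (τ : Equiv.Perm ℤ) (p : ℤ) : Divisor G :=
  D + τ p • chip u - p • chip v

variable {u v : V(G)} {K : Divisor G} {k : ℕ} {D : Divisor G} {τ : Equiv.Perm ℤ}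

theorem degree_twistAt (p : ℤ) : degree (twistAt u v D τ p) = degree D + τ p - p := by
  unfold twistAt
  rw [degree_sub, degree_add, degree_zsmul, degree_zsmul, degree_chip, degree_chip, mul_one,
    mul_one]

theorem divClass_twistAt (p : ℤ) : divClass (twistAt u v D τ p) =
    divClass D + τ p • divClass (chip u) - p • divClass (chip v) := rfl

theorem IsTransmission.delta_twistAt (hτ : IsTransmission u v D τ) (p : ℤ) :
    Delta u v (twistAt u v D τ p) = 1 := by
  rw [twistAt, ← hτ, if_pos rfl]

namespace IsGenusTwoMarking

theorem degree_twistAt_mem (h : IsGenusTwoMarking u v K k) (hτ : IsTransmission u v D τ) (p : ℤ) :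
    0 ≤ degree D + τ p - p ∧ degree D + τ p - p ≤ 4 := by
  have h1 := hτ.delta_twistAt p
  rw [← degree_twistAt (u := u) (v := v)]
  constructor <;> by_contra! hc
  · rw [delta_of_degree_neg u v hc] at h1
    norm_num at h1
  · rw [h.delta_of_five_le_degree (by omega)] at h1
    norm_num at h1

theorem dvd_of_divClass_eq (h : IsGenusTwoMarking u v K k) {p q : ℤ} (hd : τ p - p = τ q - q)
    (hc : divClass (twistAt u v D τ p) = divClass (twistAt u v D τ q)) : (k : ℤ) ∣ p - q := by
  rw [← h.zsmul_eq_zero_iff]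
  rw [divClass_twistAt, divClass_twistAt] at hc
  have hp : τ p = τ q + (p - q) := by omega
  rw [hp, ← sub_eq_zero] at hc
  rw [← hc]
  module

/-- As `m (u - v) ∼ 0`, translating both entries by `m` does not change the class of the twist, and
Δ depends only on that class. -/
theorem apply_add_of_dvd (h : IsGenusTwoMarking u v K k) (hτ : IsTransmission u v D τ) {m : ℤ}
    (hm : (k : ℤ) ∣ m) (p : ℤ) : τ (p + m) = τ p + m := by
  have h0 := (h.zsmul_eq_zero_iff m).2 hm
  have h1 := hτ (τ p + m) (p + m)
  rw [delta_congr u v (E := twistAt u v D τ p), hτ.delta_twistAt] at h1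
  · by_contra hc
    rw [if_neg hc] at h1
    norm_num at h1
  · rw [divClass_twistAt]
    simp only [divClass_add, divClass_sub, divClass_zsmul]
    rw [← sub_eq_zero, ← h0]
    module

theorem divClass_twistAt_of_zero (hτ : IsTransmission u v D τ)
    {p : ℤ} (hp : degree D + τ p - p = 0) : divClass (twistAt u v D τ p) = 0 := by
  have h1 := hτ.delta_twistAt p
  rw [delta_of_degree_zero u v (by rw [degree_twistAt, hp])] at h1
  by_contra hc
  rw [if_neg hc] at h1
  norm_num at h1

theorem divClass_twistAt_of_four (h : IsGenusTwoMarking u v K k) (hτ : IsTransmission u v D τ)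
    {p : ℤ} (hp : degree D + τ p - p = 4) : divClass (twistAt u v D τ p) =
      divClass K + divClass (chip u) + divClass (chip v) := by
  have h1 := hτ.delta_twistAt p
  rw [h.delta_of_degree_four (by rw [degree_twistAt, hp])] at h1
  by_contra hc
  rw [if_neg hc] at h1
  norm_num at h1

/-- At `u + v`, which is not canonical, the formula in degree 2 gives `1 + 0 - 1 - 1 + 1 = 0`, so
the permutation has no entry there. -/
theorem divClass_twistAt_of_two (h : IsGenusTwoMarking u v K k) (hτ : IsTransmission u v D τ)
    {p : ℤ} (hp : degree D + τ p - p = 2) : divClass (twistAt u v D τ p) ≠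
      divClass (chip u) + divClass (chip v) := by
  intro hc
  have h1 := hτ.delta_twistAt p
  have hu : SystemNonempty (twistAt u v D τ p - chip u) :=
    (systemNonempty_of_nonneg (chip_nonneg v)).of_divClass_eq (by simp [hc])
  have hv : SystemNonempty (twistAt u v D τ p - chip v) :=
    (systemNonempty_of_nonneg (chip_nonneg u)).of_divClass_eq (by simp [hc])
  rw [h.delta_of_degree_two (by rw [degree_twistAt, hp]), if_pos hu, if_pos hv, if_pos hc,
    if_neg (hc ▸ h.add_ne_canonical)] at h1
  norm_num at h1

theorem twistAt_of_three (h : IsGenusTwoMarking u v K k) (hτ : IsTransmission u v D τ)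
    {p : ℤ} (hp : degree D + τ p - p = 3) :
    SystemNonempty (twistAt u v D τ p - chip u - chip v) ∧
    divClass (twistAt u v D τ p) ≠ divClass K + divClass (chip u) ∧
    divClass (twistAt u v D τ p) ≠ divClass K + divClass (chip v) := by
  have h1 := hτ.delta_twistAt p
  rw [h.delta_of_degree_three (by rw [degree_twistAt, hp])] at h1
  split_ifs at h1 <;> simp_all

theorem dvd_of_zero (h : IsGenusTwoMarking u v K k) (hτ : IsTransmission u v D τ) {p q : ℤ}
    (hp : degree D + τ p - p = 0) (hq : degree D + τ q - q = 0) : (k : ℤ) ∣ p - q :=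
  h.dvd_of_divClass_eq (by omega)
    ((divClass_twistAt_of_zero hτ hp).trans (divClass_twistAt_of_zero hτ hq).symm)

theorem not_zero_of_succ_zero (h : IsGenusTwoMarking u v K k) (hτ : IsTransmission u v D τ)
    {p : ℤ} (hp : degree D + τ p - p = 0) : degree D + τ (p + 1) - (p + 1) ≠ 0 := by
  intro hq
  have := Int.le_of_dvd (by omega) (h.dvd_of_zero hτ hq hp)
  have := h.two_le
  omega

theorem dvd_of_four (h : IsGenusTwoMarking u v K k) (hτ : IsTransmission u v D τ) {p q : ℤ}
    (hp : degree D + τ p - p = 4) (hq : degree D + τ q - q = 4) : (k : ℤ) ∣ p - q :=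
  h.dvd_of_divClass_eq (by omega)
    ((h.divClass_twistAt_of_four hτ hp).trans (h.divClass_twistAt_of_four hτ hq).symm)

/-- Subtracting `u + v` turns the three twists into effective classes of degree 1 differing by
multiples of `u - v`, to which non-recurrence applies. -/
theorem dvd_of_three_of_three (h : IsGenusTwoMarking u v K k) (hτ : IsTransmission u v D τ)
    {p q r : ℤ} (hp : degree D + τ p - p = 3) (hq : degree D + τ q - q = 3)
    (hr : degree D + τ r - r = 3) : (k : ℤ) ∣ p - q ∨ (k : ℤ) ∣ p - r ∨ (k : ℤ) ∣ q - r := by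
  have key : ∀ s : ℤ, degree D + τ s - s = 3 → SystemNonempty
      (twistAt u v D τ p - chip u - chip v + (s - p) • (chip u - chip v)) := fun s hs => by
    have hs' : τ s = τ p + (s - p) := by omega
    have := (h.twistAt_of_three hτ hs).1
    unfold twistAt at this ⊢
    rw [hs'] at this
    convert this using 1
    module
  have := h.dvd_of_three _ (by simp [degree_twistAt, hp]) (q - p) (r - p)
    (h.twistAt_of_three hτ hp).1 (key q hq) (key r hr)
  rwa [dvd_sub_comm (b := q), dvd_sub_comm (b := r), sub_sub_sub_cancel_right] at this

/-- The twist at `p` is `K + u + v`, so the twist at `q` minus `u + v` is `K - u + (q - p)(u - v)`.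
Since `K - u` and `K - v` are effective too, non-recurrence forces `q - p` to be 0 or 1 modulo `k`,
and the twist at `q` to be `K + v` or `K + u`, where Δ is not 1. -/
theorem not_three_of_four (h : IsGenusTwoMarking u v K k) (hτ : IsTransmission u v D τ) {p q : ℤ}
    (hp : degree D + τ p - p = 4) : degree D + τ q - q ≠ 3 := by
  intro hq
  obtain ⟨h1, h2, h3⟩ := h.twistAt_of_three hτ hq
  have hp' := h.divClass_twistAt_of_four hτ hp
  have hτq : τ q = τ p - 1 + (q - p) := by omega
  have hcl : divClass (twistAt u v D τ q) = divClass K + divClass (chip v) +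
      (q - p) • (divClass (chip u) - divClass (chip v)) := by
    rw [divClass_twistAt] at hp' ⊢
    have : divClass D = divClass K + divClass (chip u) + divClass (chip v) -
      τ p • divClass (chip u) + p • divClass (chip v) := by rw [← hp']; abel
    rw [this, hτq]
    module
  rcases h.dvd_of_three (K - chip u) (by simp [h.degree_canonical]) 1 (q - p)
    (h.nonempty_canonical_sub u)
    ((h.nonempty_canonical_sub v).of_divClass_eq (by simp))
    (h1.of_divClass_eq (by
      simp only [divClass_sub, hcl, divClass_add, divClass_zsmul]; abel)) with hk | hk | hk
  · have := Int.le_of_dvd one_pos hk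
    have := h.two_le
    omega
  · rw [← h.zsmul_eq_zero_iff] at hk
    rw [hk, add_zero] at hcl
    exact h3 hcl
  · rw [← h.zsmul_eq_zero_iff, sub_smul, sub_eq_zero, one_smul] at hk
    rw [← hk, add_add_sub_cancel] at hcl
    exact h2 hcl

/-- From `p` to `q` the degree drops by `(τ p - τ q) + (q - p) ≥ 2`. Starting at 2, both differences
are 1 and the end is the trivial class, so the start is `u + v`, which is excluded. -/
theorem degree_twistAt_of_inversion (h : IsGenusTwoMarking u v K k)
    (hτ : IsTransmission u v D τ) {p q : ℤ} (hpq : p < q) (hlt : τ q < τ p) :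
    degree D + τ p - p = 3 ∨ degree D + τ p - p = 4 := by
  have hp := h.degree_twistAt_mem hτ p
  have hq := h.degree_twistAt_mem hτ q
  by_contra! hc
  have hq' : q = p + 1 := by omega
  have hτq : τ q = τ p - 1 := by omega
  have h0 := divClass_twistAt_of_zero hτ (p := q) (by omega)
  apply h.divClass_twistAt_of_two hτ (p := p) (by omega)
  rw [divClass_twistAt, hτq, hq', ← sub_eq_zero] at h0
  rw [divClass_twistAt, ← sub_eq_zero, ← h0]
  module

/-- The two drops `q - p` and `τ p - τ q` are positive with sum at most 3. Two different partners
would be `p + 1` and `p + 2`, both of degree 0, and two consecutive trivial twists would give `k ∣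
1`. -/
theorem inversion_unique_of_three (h : IsGenusTwoMarking u v K k)
    (hτ : IsTransmission u v D τ) {p q q' : ℤ} (hp : degree D + τ p - p = 3)
    (hq : p < q) (hτq : τ q < τ p) (hq' : p < q') (hτq' : τ q' < τ p) : q = q' := by
  have h1 := h.degree_twistAt_mem hτ q
  have h2 := h.degree_twistAt_mem hτ q'
  by_contra hne
  have hτne : τ q ≠ τ q' := fun hc => hne (τ.injective hc)
  have hz : ∀ {s s' : ℤ}, s = p + 1 → s' = p + 2 → degree D + τ s - s = 0 →
      degree D + τ s' - s' = 0 → False := fun {s s'} hs hs' h0 h0' => by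
    have : s' = s + 1 := by omega
    exact h.not_zero_of_succ_zero hτ h0 (this ▸ h0')
  rcases lt_or_gt_of_ne hne with hlt | hlt
  · exact hz (s := q) (s' := q') (by omega) (by omega) (by omega) (by omega)
  · exact hz (s := q') (s' := q) (by omega) (by omega) (by omega) (by omega)

/-- Now the drops have sum at most 4. Three partners would be `p + 1`, `p + 2`, `p + 3` with
`τ`-drops 3, 2, 1, all of degree 0, again with consecutive trivial twists. -/
theorem inversion_of_four (h : IsGenusTwoMarking u v K k)
    (hτ : IsTransmission u v D τ) {p q r s : ℤ} (hp : degree D + τ p - p = 4)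
    (hq : p < q) (hτq : τ q < τ p) (hr : p < r) (hτr : τ r < τ p) (hs : p < s) (hτs : τ s < τ p) :
    q = r ∨ q = s ∨ r = s := by
  have h1 := h.degree_twistAt_mem hτ q
  have h2 := h.degree_twistAt_mem hτ r
  have h3 := h.degree_twistAt_mem hτ s
  by_contra! hne
  have hqr : τ q ≠ τ r := fun hc => hne.1 (τ.injective hc)
  have hqs : τ q ≠ τ s := fun hc => hne.2.1 (τ.injective hc)
  have hrs : τ r ≠ τ s := fun hc => hne.2.2 (τ.injective hc)
  have hz : ∀ {x y : ℤ}, x = p + 1 → y = p + 2 → degree D + τ x - x = 0 →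
      degree D + τ y - y = 0 → False := fun {x y} hx hy h0 h0' => by
    have : y = x + 1 := by omega
    exact h.not_zero_of_succ_zero hτ h0 (this ▸ h0')
  have e1 : degree D + τ q - q = 0 := by omega
  have e2 : degree D + τ r - r = 0 := by omega
  have e3 : degree D + τ s - s = 0 := by omega
  have hx : q = p + 1 ∨ r = p + 1 ∨ s = p + 1 := by omega
  have hy : q = p + 2 ∨ r = p + 2 ∨ s = p + 2 := by omega
  rcases hx with hx | hx | hx <;> rcases hy with hy | hy | hy <;>
    exact hz hx hy ‹_› ‹_›

theorem card_kInversions_le (h : IsGenusTwoMarking u v K k) (hτ : IsTransmission u v D τ) :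
    Finite (KInversions k τ) ∧ Nat.card (KInversions k τ) ≤ 2 := by
  apply finite_and_card_le_two
  intro x y z
  induction x using Quotient.inductionOn with | _ x => ?_
  induction y using Quotient.inductionOn with | _ y => ?_
  induction z using Quotient.inductionOn with | _ z => ?_
  have sound : ∀ {a b : Inversion τ}, inversionSetoid k τ a b →
      (Quotient.mk (inversionSetoid k τ) a = Quotient.mk (inversionSetoid k τ) b) :=
    fun e => Quotient.sound e
  refine Or.imp sound (Or.imp sound sound) ?_
  change (x.1.1 - y.1.1 = x.1.2 - y.1.2 ∧ (k : ℤ) ∣ x.1.1 - y.1.1) ∨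
    (x.1.1 - z.1.1 = x.1.2 - z.1.2 ∧ (k : ℤ) ∣ x.1.1 - z.1.1) ∨
    (y.1.1 - z.1.1 = y.1.2 - z.1.2 ∧ (k : ℤ) ∣ y.1.1 - z.1.1)
  obtain ⟨⟨p₁, q₁⟩, h₁, t₁⟩ := x
  obtain ⟨⟨p₂, q₂⟩, h₂, t₂⟩ := y
  obtain ⟨⟨p₃, q₃⟩, h₃, t₃⟩ := z
  simp only at h₁ t₁ h₂ t₂ h₃ t₃ ⊢
  have d₁ := h.degree_twistAt_of_inversion hτ h₁ t₁
  have d₂ := h.degree_twistAt_of_inversion hτ h₂ t₂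
  have d₃ := h.degree_twistAt_of_inversion hτ h₃ t₃
  -- An inversion whose first entry is congruent to `p` is moved to one starting at `p`, so that
  -- second entries can be compared.
  have shift : ∀ {p p' q' : ℤ}, (k : ℤ) ∣ p - p' → p' < q' → τ q' < τ p' →
      p < q' + (p - p') ∧ τ (q' + (p - p')) < τ p := fun {p p' q'} hd hlt ht => by
    refine ⟨by omega, ?_⟩
    rw [h.apply_add_of_dvd hτ hd]
    have := h.apply_add_of_dvd hτ hd p'
    rw [add_sub_cancel] at this
    omega
  have of_three : ∀ {p q p' q' : ℤ}, degree D + τ p - p = 3 → (k : ℤ) ∣ p - p' → p < q →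
      τ q < τ p → p' < q' → τ q' < τ p' → p - p' = q - q' ∧ (k : ℤ) ∣ p - p' :=
    fun {p q p' q'} hp hd hq ht hq' ht' => by
      obtain ⟨e, e'⟩ := shift hd hq' ht'
      have := h.inversion_unique_of_three hτ hp hq ht e e'
      exact ⟨by omega, hd⟩
  have of_four : ∀ {p p' : ℤ}, degree D + τ p - p = 4 →
      (degree D + τ p' - p' = 3 ∨ degree D + τ p' - p' = 4) → degree D + τ p' - p' = 4 :=
    fun hp hp' => hp'.resolve_left (h.not_three_of_four hτ hp)
  by_cases h4 : degree D + τ p₁ - p₁ = 4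
  · have k₂ := h.dvd_of_four hτ h4 (of_four h4 d₂)
    have k₃ := h.dvd_of_four hτ h4 (of_four h4 d₃)
    have k₂₃ := h.dvd_of_four hτ (of_four h4 d₂) (of_four h4 d₃)
    obtain ⟨e₂, e₂'⟩ := shift k₂ h₂ t₂
    obtain ⟨e₃, e₃'⟩ := shift k₃ h₃ t₃
    rcases h.inversion_of_four hτ h4 h₁ t₁ e₂ e₂' e₃ e₃' with e | e | e
    · exact Or.inl ⟨by omega, k₂⟩
    · exact Or.inr (Or.inl ⟨by omega, k₃⟩)
    · exact Or.inr (Or.inr ⟨by omega, k₂₃⟩)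
  · have a₁ := d₁.resolve_right h4
    have a₂ := d₂.resolve_right fun hc => h.not_three_of_four hτ hc a₁
    have a₃ := d₃.resolve_right fun hc => h.not_three_of_four hτ hc a₁
    rcases h.dvd_of_three_of_three hτ a₁ a₂ a₃ with e | e | e
    · exact Or.inl (of_three a₁ e h₁ t₁ h₂ t₂)
    · exact Or.inr (Or.inl (of_three a₁ e h₁ t₁ h₃ t₃))
    · exact Or.inr (Or.inr (of_three a₂ e h₂ t₂ h₃ t₃))

theorem addOrderOf_eq (h : IsGenusTwoMarking u v K k) :
    addOrderOf (divClass (chip u - chip v)) = k := by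
  refine Nat.dvd_antisymm ?_ ?_
  · rw [addOrderOf_dvd_iff_nsmul_eq_zero, ← natCast_zsmul, divClass_sub, h.zsmul_eq_zero_iff]
  · rw [← Int.natCast_dvd_natCast, ← h.zsmul_eq_zero_iff, natCast_zsmul, ← divClass_sub]
    exact addOrderOf_nsmul_eq_zero _

/-- `dvd_of_three` with base divisor `w`: the exponents `0, m, m'` cannot be pairwise incongruent
modulo `k`. -/
theorem nonRecurrent (h : IsGenusTwoMarking u v K k) : NonRecurrent (chip u - chip v) := by
  rintro w m ⟨hm, hmk, hmn⟩ m' ⟨hm', hmk', hmn'⟩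
  rw [h.addOrderOf_eq] at hmk hmk'
  rw [add_comm, ← natCast_zsmul] at hmn hmn'
  have hnot : ∀ x : ℤ, 0 < x → x < k → ¬ (k : ℤ) ∣ x := fun x hx hxk hc =>
    absurd (Int.le_of_dvd hx hc) (not_le.2 hxk)
  rcases h.dvd_of_three (chip w) (degree_chip w) m m'
    (systemNonempty_of_nonneg (chip_nonneg w)) hmn hmn' with hd | hd | hd
  · exact absurd hd (hnot _ (by omega) (by omega))
  · exact absurd hd (hnot _ (by omega) (by omega))
  · have := Int.eq_zero_of_abs_lt_dvd hd (by rw [abs_lt]; omega)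
    omega

theorem hasGeneralTransmission (h : IsGenusTwoMarking u v K k) (hg : genus G = 2) :
    HasGeneralTransmission G u v k := by
  refine ⟨by have := h.two_le; omega, ?_, fun D => ⟨fun a b => h.delta_nonneg _, ?_⟩⟩
  · have := (h.zsmul_eq_zero_iff k).2 dvd_rfl
    rw [natCast_zsmul, nsmul_sub, sub_eq_zero] at this
    exact this
  · obtain ⟨τ, hτ⟩ := h.exists_isTransmission D
    obtain ⟨hf, hc⟩ := h.card_kInversions_le hτ
    exact ⟨τ, hτ, hf, by rw [hg]; exact_mod_cast hc⟩

end IsGenusTwoMarking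

end GenusTwo

/-! ### The Picard group of a theta graph in coordinates -/

section Theta

variable (n : Fin 3 → ℕ)

theorem genus_thetaGraph (hn : ∀ a, 1 ≤ n a) : genus (thetaGraph n) = 2 := by
  have hE : E(thetaGraph n) = Set.univ := by
    ext e
    simp only [Set.mem_univ, iff_true]
    exact (Graph.edge_mem_iff_exists_isLink ..).2 ⟨_, _, rfl⟩
  have hV : V(thetaGraph n) = Set.univ := rfl
  unfold genus
  rw [hE, hV, Set.ncard_univ, Set.ncard_univ, Nat.card_eq_fintype_card, Nat.card_eq_fintype_card,
    Fintype.card_sigma, Fintype.card_sum, Fintype.card_sigma]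
  simp only [Fintype.card_fin, Fintype.card_bool]
  have h3 : ∀ f : Fin 3 → ℕ, ∑ x : Fin (2 + 1), f x = f 0 + f 1 + f 2 := Fin.sum_univ_three
  rw [h3, h3]
  have := hn 0
  have := hn 1
  have := hn 2
  omega

variable {n}

theorem thetaVertex_zero (a b : Fin 3) : thetaVertex n a 0 = thetaVertex n b 0 := rfl

theorem thetaVertex_of_interior {a : Fin 3} {i : ℕ} (hi : 0 < i) (hia : i < n a) :
    (thetaVertex n a i).1 = Sum.inr ⟨a, ⟨i - 1, by omega⟩⟩ := by
  change bananaLabel (g := 2) n a i = _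
  unfold bananaLabel
  rw [if_neg (by omega), dif_pos (by omega)]

theorem thetaVertex_of_end (hn : ∀ a, 1 ≤ n a) (a : Fin 3) :
    (thetaVertex n a (n a)).1 = Sum.inl true := by
  change bananaLabel (g := 2) n a (n a) = _
  have := hn a
  unfold bananaLabel
  rw [if_neg (by omega), dif_neg (by omega)]

theorem thetaVertex_end_eq (hn : ∀ a, 1 ≤ n a) (a b : Fin 3) :
    thetaVertex n a (n a) = thetaVertex n b (n b) :=
  Subtype.ext ((thetaVertex_of_end hn a).trans (thetaVertex_of_end hn b).symm)

theorem exists_eq_thetaVertex (hn : ∀ a, 1 ≤ n a) (w : V(thetaGraph n)) :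
    w = thetaVertex n 0 (n 0) ∨ ∃ a i, i < n a ∧ w = thetaVertex n a i := by
  obtain ⟨w, hw⟩ := w
  rcases w with (_ | _) | ⟨a, i, hi⟩
  · exact Or.inr ⟨0, 0, hn 0, rfl⟩
  · exact Or.inl (Subtype.ext (thetaVertex_of_end hn 0).symm)
  · refine Or.inr ⟨a, i + 1, by omega, Subtype.ext ?_⟩
    rw [thetaVertex_of_interior (by omega) (by omega)]
    rfl

theorem thetaVertex_eq_interior_iff (hn : ∀ a, 1 ≤ n a) {a b : Fin 3} {i j : ℕ} (hi : 0 < i)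
    (hia : i < n a) (hj : j ≤ n b) : thetaVertex n b j = thetaVertex n a i ↔ b = a ∧ j = i := by
  constructor
  · intro h
    have h1 := congrArg Subtype.val h
    rw [thetaVertex_of_interior hi hia] at h1
    rcases Nat.eq_zero_or_pos j with rfl | hj0
    · exact absurd h1 (by rintro ⟨⟩)
    rcases hj.eq_or_lt with rfl | hj1
    · rw [thetaVertex_of_end hn] at h1
      exact absurd h1 (by rintro ⟨⟩)
    · rw [thetaVertex_of_interior hj0 hj1] at h1
      have h2 := Sum.inr.inj h1
      have hba := (Sigma.mk.inj h2).1
      subst hba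
      have h3 := congrArg Fin.val (eq_of_heq (Sigma.mk.inj h2).2)
      simp only at h3
      exact ⟨rfl, by omega⟩
  · rintro ⟨rfl, rfl⟩
    rfl

theorem thetaVertex_eq_zero_iff (hn : ∀ a, 1 ≤ n a) {a b : Fin 3} {j : ℕ} (hj : j ≤ n b) :
    thetaVertex n b j = thetaVertex n a 0 ↔ j = 0 := by
  constructor
  · intro h
    by_contra hj0
    have h1 := congrArg Subtype.val h
    have h2 : (thetaVertex n a 0).1 = Sum.inl false := rfl
    rw [h2] at h1
    rcases hj.eq_or_lt with rfl | hj1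
    · rw [thetaVertex_of_end hn] at h1
      simp at h1
    · rw [thetaVertex_of_interior (by omega) hj1] at h1
      exact absurd h1 (by rintro ⟨⟩)
  · rintro rfl
    rfl

theorem isLink_thetaGraph_iff {e : BananaEdge (g := 2) n} {x y : V(thetaGraph n)} :
    (thetaGraph n).IsLink e x y ↔
      s(x, y) = s(thetaVertex n e.1 e.2, thetaVertex n e.1 (e.2 + 1)) := by
  change s(x.1, y.1) = s((thetaVertex n e.1 e.2).1, (thetaVertex n e.1 (e.2 + 1)).1) ↔ _
  simp only [Sym2.eq_iff, Subtype.ext_iff]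

open Classical in
theorem edgeMult_thetaGraph (x y : V(thetaGraph n)) : (edgeMult (thetaGraph n) x y : ℤ) =
    ∑ e : BananaEdge (g := 2) n,
      if s(x, y) = s(thetaVertex n e.1 e.2, thetaVertex n e.1 (e.2 + 1)) then 1 else 0 := by
  unfold edgeMult
  rw [Finset.sum_boole, Set.ncard_eq_toFinset_card']
  congr 2
  ext e
  simp only [Set.mem_toFinset, Set.mem_ofPred_eq, Finset.mem_filter, Finset.mem_univ, true_and]
  exact isLink_thetaGraph_iff

-- Summing over edges instead of pairs of vertices lets principal divisors be computed strand by
-- strand.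
open Classical in
theorem fire_thetaGraph_apply (f : V(thetaGraph n) → ℤ) (x : V(thetaGraph n)) :
    fire (thetaGraph n) f x = ∑ e : BananaEdge (g := 2) n,
      (f (thetaVertex n e.1 (e.2 + 1)) - f (thetaVertex n e.1 e.2)) *
        (chip (thetaVertex n e.1 e.2) x - chip (thetaVertex n e.1 (e.2 + 1)) x) := by
  change ∑ y, (edgeMult (thetaGraph n) x y : ℤ) * (f y - f x) = _
  simp only [edgeMult_thetaGraph, Finset.sum_mul]
  rw [Finset.sum_comm]
  refine Finset.sum_congr rfl fun e _ => ?_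
  generalize thetaVertex n e.1 e.2 = l
  generalize thetaVertex n e.1 (e.2 + 1) = r
  unfold chip
  by_cases hl : x = l
  · subst hl
    simp only [Sym2.congr_right, ite_mul, one_mul, zero_mul, Finset.sum_ite_eq', Finset.mem_univ,
      if_true]
    split_ifs with hr
    · subst hr; ring
    · ring
  · by_cases hr : x = r
    · subst hr
      simp only [Sym2.eq_swap (a := l), Sym2.congr_right, ite_mul, one_mul, zero_mul,
        Finset.sum_ite_eq', Finset.mem_univ, if_true, if_neg hl]
      ring
    · have : ∀ y, s(x, y) ≠ s(l, r) := fun y h => by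
        rw [Sym2.eq_iff] at h
        tauto
      simp [this, hl, hr]

theorem fire_thetaGraph (f : V(thetaGraph n) → ℤ) :
    fire (thetaGraph n) f = ∑ a, ∑ i ∈ Finset.range (n a),
      (f (thetaVertex n a (i + 1)) - f (thetaVertex n a i)) •
        (chip (thetaVertex n a i) - chip (thetaVertex n a (i + 1))) := by
  funext x
  rw [fire_thetaGraph_apply, Fintype.sum_sigma, Finset.sum_apply]
  refine Finset.sum_congr rfl fun a _ => ?_
  rw [Finset.sum_apply, ← Fin.sum_univ_eq_sum_range (fun i =>
    ((f (thetaVertex n a (i + 1)) - f (thetaVertex n a i)) •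
        (chip (thetaVertex n a i) - chip (thetaVertex n a (i + 1)))) x)]
  rfl

/-- The class of the divisor `v_{a,1} - v_{a,0}`. -/
noncomputable def edgeClass (n : Fin 3 → ℕ) (a : Fin 3) : Pic (thetaGraph n) :=
  divClass (chip (thetaVertex n a 1)) - divClass (chip (thetaVertex n a 0))

theorem divClass_sum {α β ι : Type*} {G : Graph α β} [Fintype V(G)] (s : Finset ι)
    (D : ι → Divisor G) : divClass (∑ i ∈ s, D i) = ∑ i ∈ s, divClass (D i) :=
  map_sum (QuotientAddGroup.mk' (principal G)) D s

theorem sum_fire_thetaGraph_eq_zero (f : V(thetaGraph n) → ℤ) :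
    ∑ a, ∑ i ∈ Finset.range (n a),
      (f (thetaVertex n a (i + 1)) - f (thetaVertex n a i)) •
        (divClass (chip (thetaVertex n a i)) - divClass (chip (thetaVertex n a (i + 1)))) = 0 := by
  rw [← divClass_fire f, fire_thetaGraph]
  simp only [divClass_sum]
  rfl

/-- This is the relation from firing the trivalent vertex `v_{a,0}`. -/
theorem sum_edgeClass (hn : ∀ a, 1 ≤ n a) : ∑ a, edgeClass n a = 0 := by
  rw [← sum_fire_thetaGraph_eq_zero (chip (thetaVertex n 0 0))]
  refine Finset.sum_congr rfl fun a _ => ?_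
  rw [Finset.sum_eq_single_of_mem 0 (Finset.mem_range.2 (hn a))]
  · have h1 : chip (thetaVertex n 0 0) (thetaVertex n a (0 + 1)) = 0 :=
      if_neg ((thetaVertex_eq_zero_iff hn (hn a)).not.2 one_ne_zero)
    have h2 : chip (thetaVertex n 0 0) (thetaVertex n a 0) = 1 := if_pos rfl
    rw [h1, h2, zero_add, edgeClass]
    module
  · intro i hi hi0
    rw [Finset.mem_range] at hi
    have h1 : chip (thetaVertex n 0 0) (thetaVertex n a (i + 1)) = 0 :=
      if_neg ((thetaVertex_eq_zero_iff hn hi).not.2 (by omega))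
    have h2 : chip (thetaVertex n 0 0) (thetaVertex n a i) = 0 :=
      if_neg ((thetaVertex_eq_zero_iff hn hi.le).not.2 hi0)
    rw [h1, h2, sub_self, zero_smul]

/-- Firing an interior vertex shows that consecutive edges of a strand have the same class, so one
class per strand suffices. -/
theorem divClass_thetaVertex_step (hn : ∀ a, 1 ≤ n a) {a : Fin 3} {i : ℕ} (hi : 0 < i)
    (hia : i < n a) :
    divClass (chip (thetaVertex n a (i + 1))) - divClass (chip (thetaVertex n a i)) =
      divClass (chip (thetaVertex n a i)) - divClass (chip (thetaVertex n a (i - 1))) := by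
  classical
  have h := sum_fire_thetaGraph_eq_zero (chip (thetaVertex n a i))
  have hchip : ∀ b j, j ≤ n b → chip (thetaVertex n a i) (thetaVertex n b j) =
      if b = a ∧ j = i then 1 else 0 := fun b j hj => by
    unfold chip
    simp only [thetaVertex_eq_interior_iff hn hi hia hj]
  rw [Finset.sum_eq_single_of_mem a (Finset.mem_univ a)] at h
  · rw [Finset.sum_congr rfl (g := fun j => (if i - 1 = j then
        divClass (chip (thetaVertex n a j)) - divClass (chip (thetaVertex n a (j + 1))) else 0) -
        if i = j then
        divClass (chip (thetaVertex n a j)) - divClass (chip (thetaVertex n a (j + 1))) else 0),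
      Finset.sum_sub_distrib, Finset.sum_ite_eq, Finset.sum_ite_eq,
      if_pos (Finset.mem_range.2 (by omega)), if_pos (Finset.mem_range.2 hia),
      Nat.sub_add_cancel hi] at h
    · rw [← sub_eq_zero, ← h]
      abel
    · intro j hj
      rw [Finset.mem_range] at hj
      rw [hchip _ _ hj, hchip _ _ hj.le, sub_smul]
      have e1 : j + 1 = i ↔ i - 1 = j := by omega
      simp only [true_and, e1, eq_comm (a := j) (b := i), ite_smul, one_smul, zero_smul]
  · intro b _ hb
    refine Finset.sum_eq_zero fun j hj => ?_
    rw [Finset.mem_range] at hj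
    rw [hchip _ _ hj, hchip _ _ hj.le]
    simp [hb]

theorem divClass_thetaVertex (hn : ∀ a, 1 ≤ n a) {a : Fin 3} {i : ℕ} (hia : i ≤ n a) :
    divClass (chip (thetaVertex n a i)) =
      divClass (chip (thetaVertex n 0 0)) + (i : ℤ) • edgeClass n a := by
  have key : ∀ i < n a, divClass (chip (thetaVertex n a (i + 1))) -
      divClass (chip (thetaVertex n a i)) = edgeClass n a := fun i hi => by
    induction i with
    | zero => rfl
    | succ i ih =>
      rw [divClass_thetaVertex_step hn (by omega) hi]
      exact ih (by omega)
  induction i with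
  | zero => rw [Nat.cast_zero, zero_smul, add_zero]; rfl
  | succ i ih =>
    rw [← sub_add_cancel (divClass (chip (thetaVertex n a (i + 1)))), key i (by omega),
      ih (by omega)]
    push_cast
    module

theorem length_smul_edgeClass (hn : ∀ a, 1 ≤ n a) (a b : Fin 3) :
    (n a : ℤ) • edgeClass n a = (n b : ℤ) • edgeClass n b := by
  have ha := divClass_thetaVertex hn (le_refl (n a))
  have hb := divClass_thetaVertex hn (le_refl (n b))
  rw [thetaVertex_end_eq hn a b, hb] at ha
  exact (add_left_cancel ha).symm

/-- The `a`-th coordinate of a vertex: `v_{b,i}` has `i` on strand `b` and `0` elsewhere; the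
vertex at the far end is regarded as lying on strand `0`. -/
def thetaPos (n : Fin 3 → ℕ) (a : Fin 3) (x : V(thetaGraph n)) : ℤ :=
  match x.1 with
  | Sum.inl false => 0
  | Sum.inl true => if a = 0 then n 0 else 0
  | Sum.inr ⟨b, i⟩ => if a = b then (i : ℤ) + 1 else 0

theorem thetaPos_thetaVertex {a b : Fin 3} {i : ℕ} (hi : i < n b) :
    thetaPos n a (thetaVertex n b i) = if a = b then (i : ℤ) else 0 := by
  rcases Nat.eq_zero_or_pos i with rfl | hi0
  · have : thetaPos n a (thetaVertex n b 0) = 0 := rfl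
    simp [this]
  · unfold thetaPos
    rw [thetaVertex_of_interior hi0 hi]
    simp only
    congr 1
    push_cast [Nat.cast_sub hi0]
    ring

theorem thetaPos_end (hn : ∀ a, 1 ≤ n a) (a b : Fin 3) :
    thetaPos n a (thetaVertex n b (n b)) = if a = 0 then (n 0 : ℤ) else 0 := by
  unfold thetaPos
  rw [thetaVertex_of_end hn]

/-- The `a`-th coordinate of a divisor. -/
def coord (a : Fin 3) : Divisor (thetaGraph n) →+ ℤ where
  toFun D := ∑ x, D x * thetaPos n a x
  map_zero' := by simp
  map_add' D E := by simp [add_mul, Finset.sum_add_distrib]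

theorem coord_chip (a : Fin 3) (x : V(thetaGraph n)) : coord a (chip x) = thetaPos n a x := by
  change ∑ y, chip x y * thetaPos n a y = _
  simp [chip]

/-- On strand `b` the coordinate `b` grows by 1 along every edge but the last, so the sum
telescopes. The last edge jumps to the far end, counted as a point of strand 0, and contributes the
terms in `n b` and `n 0`. -/
theorem coord_fire (hn : ∀ a, 1 ≤ n a) (f : V(thetaGraph n) → ℤ) :
    ∃ (c : ℤ) (m : Fin 3 → ℤ), ∑ a, m a = 0 ∧
      ∀ a, coord a (fire (thetaGraph n) f) = c + n a * m a := by
  set d : Fin 3 → ℤ := fun b => f (thetaVertex n b (n b)) - f (thetaVertex n b (n b - 1)) with hd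
  -- `d b` is the increment of `f` on the last edge of strand `b`; the correction on strand 0 makes
  -- the `m a` sum to zero.
  refine ⟨f (thetaVertex n 0 0) - f (thetaVertex n 0 (n 0)),
    fun a => d a - if a = 0 then ∑ b, d b else 0, by simp, fun a => ?_⟩
  have hstrand : ∀ b, ∑ i ∈ Finset.range (n b),
      (f (thetaVertex n b (i + 1)) - f (thetaVertex n b i)) *
        (thetaPos n a (thetaVertex n b i) - thetaPos n a (thetaVertex n b (i + 1))) =
      (if a = b then f (thetaVertex n 0 0) - f (thetaVertex n 0 (n 0)) + n b * d b else 0) -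
        (if a = 0 then n 0 else 0) * d b := fun b => by
    obtain ⟨m, hm⟩ : ∃ m, n b = m + 1 := ⟨n b - 1, by have := hn b; omega⟩
    have hend : thetaVertex n b (m + 1) = thetaVertex n 0 (n 0) := by
      rw [← hm]; exact thetaVertex_end_eq hn b 0
    have hdb : d b = f (thetaVertex n 0 (n 0)) - f (thetaVertex n b m) := by
      simp only [hd, hm, Nat.add_sub_cancel, hend]
    rw [hm, Finset.sum_range_succ, Finset.sum_congr rfl (g := fun i =>
      (f (thetaVertex n b (i + 1)) - f (thetaVertex n b i)) * (if a = b then -1 else 0)),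
      ← Finset.sum_mul, Finset.sum_range_sub (fun i => f (thetaVertex n b i)),
      thetaPos_thetaVertex (by omega), hend, thetaPos_end hn, hdb, thetaVertex_zero b 0]
    · split_ifs <;> push_cast <;> ring
    · intro i hi
      rw [Finset.mem_range] at hi
      rw [thetaPos_thetaVertex (by omega), thetaPos_thetaVertex (by omega)]
      split_ifs <;> push_cast <;> ring
  have hsum : coord a (fire (thetaGraph n) f) = ∑ b, ∑ i ∈ Finset.range (n b),
      (f (thetaVertex n b (i + 1)) - f (thetaVertex n b i)) *
        (thetaPos n a (thetaVertex n b i) - thetaPos n a (thetaVertex n b (i + 1))) := by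
    rw [fire_thetaGraph, map_sum]
    refine Finset.sum_congr rfl fun b _ => ?_
    rw [map_sum]
    refine Finset.sum_congr rfl fun i _ => ?_
    rw [map_zsmul, map_sub, coord_chip, coord_chip, smul_eq_mul]
  rw [hsum, Finset.sum_congr rfl fun b _ => hstrand b, Finset.sum_sub_distrib, Finset.sum_ite_eq, if_pos (Finset.mem_univ a), ← Finset.mul_sum]
  by_cases ha : a = 0
  · subst ha; simp only [if_true]; ring
  · simp only [if_neg ha]; push_cast; ring

theorem sum_smul_add_sum_smul {A ι κ : Type*} [AddCommGroup A] [Fintype ι] [Fintype κ]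
    (d : ι → ℤ) (t : κ → ι → ℤ) (p : A) (e : κ → A) :
    ∑ x, d x • (p + ∑ a, t a x • e a) = (∑ x, d x) • p + ∑ a, (∑ x, d x * t a x) • e a := by
  simp only [smul_add, Finset.sum_add_distrib, Finset.sum_smul, Finset.smul_sum, smul_smul]
  rw [Finset.sum_comm]

theorem divClass_eq_coord (hn : ∀ a, 1 ≤ n a) (D : Divisor (thetaGraph n)) :
    divClass D = degree D • divClass (chip (thetaVertex n 0 0)) +
      ∑ a, coord a D • edgeClass n a := by
  have hw : ∀ w, divClass (chip w) = divClass (chip (thetaVertex n 0 0)) +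
      ∑ a, thetaPos n a w • edgeClass n a := fun w => by
    rcases exists_eq_thetaVertex hn w with rfl | ⟨b, i, hi, rfl⟩
    · rw [divClass_thetaVertex hn le_rfl]
      simp [thetaPos_end hn, ite_smul]
    · rw [divClass_thetaVertex hn hi.le]
      simp [thetaPos_thetaVertex hi, ite_smul]
  have hD : D = ∑ x, D x • chip x := by
    classical
    funext y
    simp [chip]
  conv_lhs => rw [hD]
  rw [divClass_sum]
  simp only [divClass_zsmul]
  rw [Finset.sum_congr rfl fun x _ => congrArg (D x • ·) (hw x)]
  exact sum_smul_add_sum_smul _ _ _ _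

/-- `coord_fire` shows that principal divisors have coordinates in the lattice. Conversely
`sum_edgeClass` and `length_smul_edgeClass` kill every lattice vector. -/
theorem divClass_eq_iff_coord (hn : ∀ a, 1 ≤ n a) {D E : Divisor (thetaGraph n)} :
    divClass D = divClass E ↔ degree D = degree E ∧ ∃ (c : ℤ) (m : Fin 3 → ℤ), ∑ a, m a = 0 ∧
      ∀ a, coord a D - coord a E = c + n a * m a := by
  constructor
  · intro h
    refine ⟨LinEquiv.degree_eq h, ?_⟩
    obtain ⟨f, hf⟩ := divClass_eq_iff.1 h.symm
    have := coord_fire hn f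
    rw [hf] at this
    simpa only [map_sub] using this
  · rintro ⟨hd, c, m, hm, h⟩
    rw [divClass_eq_coord hn D, divClass_eq_coord hn E, hd]
    congr 1
    rw [← sub_eq_zero, ← Finset.sum_sub_distrib]
    simp only [← sub_smul, h, add_smul, Finset.sum_add_distrib]
    rw [← Finset.smul_sum, sum_edgeClass hn, smul_zero, zero_add]
    have : ∀ a, ((n a : ℤ) * m a) • edgeClass n a = m a • ((n 0 : ℤ) • edgeClass n 0) := fun a => by
      rw [mul_comm, mul_smul, length_smul_edgeClass hn a 0]
    simp only [this]
    rw [← Finset.sum_smul, hm, zero_smul]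

end Theta

/-! ### Sign arguments for lattice relations -/

section Arithmetic

/-- `X, Y, Z` model the difference of two vertex vectors: bounded by the strand lengths, with at
most one positive. If `C > 0`, the bounds give `M, M' < k` and `g ≤ 0`. For `g = 0`, `Z > 0` forces
`M, M' < 0`, contradicting their zero sum; for `g < 0`, `M + M' ≥ k` forces both positive, so `X, Y
> 0`. -/
theorem nonpos_of_balanced {A B N k C M M' g X Y Z : ℤ} (hA : 0 < A) (hB : 0 < B) (hN : 0 < N)
    (hX : X = C + A * M) (hY : Y = C + B * M') (hZ : Z = C + N * g)
    (hsum : M + M' + k * g = 0) (hk : 0 < k) (hXu : X ≤ k * A) (hYu : Y ≤ k * B) (hZu : Z ≤ N)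
    (hXY : X ≤ 0 ∨ Y ≤ 0) (hXZ : X ≤ 0 ∨ Z ≤ 0) (hYZ : Y ≤ 0 ∨ Z ≤ 0) : C ≤ 0 := by
  by_contra! hC
  have hM : M < k := lt_of_mul_lt_mul_left (a := A) (by linarith) hA.le
  have hM' : M' < k := lt_of_mul_lt_mul_left (a := B) (by linarith) hB.le
  have hg : g < 1 := lt_of_mul_lt_mul_left (a := N) (by linarith) hN.le
  rcases (Int.lt_add_one_iff.1 hg : g ≤ 0).eq_or_lt with rfl | hg'
  · have hX0 : X ≤ 0 := hXZ.resolve_right (by omega)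
    have hY0 : Y ≤ 0 := hYZ.resolve_right (by omega)
    have : M < 0 := by
      by_contra! hc
      have := mul_nonneg hA.le hc
      omega
    have : M' < 0 := by
      by_contra! hc
      have := mul_nonneg hB.le hc
      omega
    omega
  · have hkg : k * g ≤ k * (-1) := mul_le_mul_of_nonneg_left (by omega) hk.le
    have := mul_pos hA (show 0 < M by omega)
    have := mul_pos hB (show 0 < M' by omega)
    omega

theorem eq_zero_of_balanced {A B N k C M M' g X Y Z : ℤ} (hA : 0 < A) (hB : 0 < B) (hN : 0 < N)
    (hX : X = C + A * M) (hY : Y = C + B * M') (hZ : Z = C + N * g)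
    (hsum : M + M' + k * g = 0) (hk : 0 < k) (hM : ¬ k ∣ M)
    (hXu : X ≤ k * A) (hYu : Y ≤ k * B) (hZu : Z ≤ N)
    (hXl : -X ≤ k * A) (hYl : -Y ≤ k * B) (hZl : -Z ≤ N)
    (hXY : X ≤ 0 ∨ Y ≤ 0) (hXZ : X ≤ 0 ∨ Z ≤ 0) (hYZ : Y ≤ 0 ∨ Z ≤ 0)
    (hXY' : -X ≤ 0 ∨ -Y ≤ 0) (hXZ' : -X ≤ 0 ∨ -Z ≤ 0) (hYZ' : -Y ≤ 0 ∨ -Z ≤ 0) :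
    C = 0 ∧ g = 0 ∧ -k < M ∧ M < k := by
  have h1 := nonpos_of_balanced hA hB hN hX hY hZ hsum hk hXu hYu hZu hXY hXZ hYZ
  have h2 := nonpos_of_balanced (C := -C) (M := -M) (M' := -M') (g := -g) hA hB hN
    (by linarith) (by linarith) (by linarith) (by linarith) hk hXl hYl hZl hXY' hXZ' hYZ'
  obtain rfl : C = 0 := by omega
  have hM0 : M ≠ 0 := by rintro rfl; exact hM (dvd_zero _)
  have hM0' : M' ≠ 0 := by
    rintro rfl
    exact hM ⟨-g, by linarith⟩
  have hX0 : X ≠ 0 := by rw [hX, zero_add]; exact mul_ne_zero hA.ne' hM0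
  have hY0 : Y ≠ 0 := by rw [hY, zero_add]; exact mul_ne_zero hB.ne' hM0'
  have hZ0 : Z = 0 := by omega
  have hg : g = 0 := by
    rw [hZ, zero_add] at hZ0
    exact (mul_eq_zero.1 hZ0).resolve_left hN.ne'
  have e1 : M ≤ k := le_of_mul_le_mul_left (a := A) (by linarith) hA
  have e2 : -M ≤ k := le_of_mul_le_mul_left (a := A) (by linarith) hA
  have e3 : M ≠ k := by rintro rfl; exact hM dvd_rfl
  have e4 : -M ≠ k := by rintro rfl; exact hM (by simp)
  exact ⟨rfl, hg, by omega, by omega⟩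

/-- The sign of `C` decides. If `C < 0`, none of `x, y, z` is negative and the one belonging to a
vanishing `X` or `Y` is positive; if `C > 0`, none is positive and `z < 0`. If `C = 0`, `t` would be
a multiple of `k`. -/
theorem not_balanced_of_corner {A B N k t C X Y Z x y z : ℤ} (hA : 0 < A) (hB : 0 < B)
    (hN : 0 < N) (ht : 0 < t) (htk : t < k) (hX : t * A - X = C + k * A * x)
    (hY : t * B - Y = C + k * B * y) (hZ : -Z = C + N * z) (hsum : x + y + z = 0)
    (hX0 : 0 ≤ X) (hY0 : 0 ≤ Y) (hZ0 : 0 ≤ Z) (hXu : X ≤ k * A) (hYu : Y ≤ k * B) (hZu : Z ≤ N)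
    (hXY : X = 0 ∨ Y = 0) : False := by
  have hk : 0 < k := ht.trans htk
  have hkA := mul_pos hk hA
  have hkB := mul_pos hk hB
  have htA := mul_pos ht hA
  have htB := mul_pos ht hB
  have htkA : t * A < k * A := mul_lt_mul_of_pos_right htk hA
  have htkB : t * B < k * B := mul_lt_mul_of_pos_right htk hB
  rcases lt_trichotomy C 0 with hC | rfl | hC
  · have hx : -1 < x := lt_of_mul_lt_mul_left (a := k * A) (by linarith) hkA.le
    have hy : -1 < y := lt_of_mul_lt_mul_left (a := k * B) (by linarith) hkB.le
    have hz : -1 < z := lt_of_mul_lt_mul_left (a := N) (by linarith) hN.le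
    rcases hXY with rfl | rfl
    · have : 0 < x := lt_of_mul_lt_mul_left (a := k * A) (by linarith) hkA.le
      omega
    · have : 0 < y := lt_of_mul_lt_mul_left (a := k * B) (by linarith) hkB.le
      omega
  · rcases hXY with rfl | rfl
    · have h1 : 0 < x := lt_of_mul_lt_mul_left (a := k * A) (by linarith) hkA.le
      have h2 : x < 1 := lt_of_mul_lt_mul_left (a := k * A) (by linarith) hkA.le
      omega
    · have h1 : 0 < y := lt_of_mul_lt_mul_left (a := k * B) (by linarith) hkB.le
      have h2 : y < 1 := lt_of_mul_lt_mul_left (a := k * B) (by linarith) hkB.le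
      omega
  · have hx : x < 1 := lt_of_mul_lt_mul_left (a := k * A) (by linarith) hkA.le
    have hy : y < 1 := lt_of_mul_lt_mul_left (a := k * B) (by linarith) hkB.le
    have hz : z < 0 := lt_of_mul_lt_mul_left (a := N) (by linarith) hN.le
    omega

end Arithmetic

/-! ### Coordinate vectors and effective classes -/

/-- Equivalence of coordinate vectors: they differ by an element of the lattice generated by
`(1, 1, 1)` and the vectors `n a ε_a - n b ε_b`. -/
def CoordEquiv (n : Fin 3 → ℕ) (x y : Fin 3 → ℤ) : Prop :=
  ∃ (c : ℤ) (m : Fin 3 → ℤ), ∑ a, m a = 0 ∧ ∀ a, x a - y a = c + n a * m a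

namespace CoordEquiv

variable {n : Fin 3 → ℕ} {x y z x' y' : Fin 3 → ℤ}

theorem refl (x : Fin 3 → ℤ) : CoordEquiv n x x := ⟨0, 0, by simp, by simp⟩

theorem symm (h : CoordEquiv n x y) : CoordEquiv n y x := by
  obtain ⟨c, m, hm, h⟩ := h
  exact ⟨-c, -m, by simp [hm], fun a => by rw [← neg_sub, h, Pi.neg_apply]; ring⟩

theorem add (h : CoordEquiv n x y) (h' : CoordEquiv n x' y') :
    CoordEquiv n (x + x') (y + y') := by
  obtain ⟨c, m, hm, h⟩ := h
  obtain ⟨c', m', hm', h'⟩ := h'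
  refine ⟨c + c', m + m', by simp [Finset.sum_add_distrib, hm, hm'], fun a => ?_⟩
  have := h a
  have := h' a
  simp only [Pi.add_apply]
  linarith

theorem neg (h : CoordEquiv n x y) : CoordEquiv n (-x) (-y) := by
  obtain ⟨c, m, hm, h⟩ := h
  refine ⟨-c, -m, by simp [hm], fun a => ?_⟩
  have := h a
  simp only [Pi.neg_apply]
  linarith

theorem sub (h : CoordEquiv n x y) (h' : CoordEquiv n x' y') :
    CoordEquiv n (x - x') (y - y') := by
  rw [sub_eq_add_neg, sub_eq_add_neg]
  exact h.add h'.neg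

theorem trans (h : CoordEquiv n x y) (h' : CoordEquiv n y z) : CoordEquiv n x z := by
  have := h.add h'
  have := this.sub (CoordEquiv.refl (n := n) y)
  simpa [add_comm y] using this

theorem single (n : Fin 3 → ℕ) (a b : Fin 3) :
    CoordEquiv n (Pi.single a (n a : ℤ)) (Pi.single b (n b : ℤ)) := by
  refine ⟨0, Pi.single a 1 - Pi.single b 1, by simp, fun d => ?_⟩
  simp only [Pi.single_apply, Pi.sub_apply]
  split_ifs <;> simp_all

end CoordEquiv

/-- The coordinate vectors of the points of the strands. -/
def IsVertexVector (n : Fin 3 → ℕ) (x : Fin 3 → ℤ) : Prop :=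
  (∀ a, 0 ≤ x a ∧ x a ≤ n a) ∧ ∀ a b, a ≠ b → x a = 0 ∨ x b = 0

theorem isVertexVector_single {n : Fin 3 → ℕ} {a : Fin 3} {i : ℤ} (hi : 0 ≤ i) (hia : i ≤ n a) :
    IsVertexVector n (Pi.single a i) := by
  refine ⟨fun b => ?_, fun b c hbc => ?_⟩
  · by_cases h : b = a
    · subst h; simp [hi, hia]
    · simp [h]
  · by_contra! h
    have hb : b = a := by by_contra hc; exact h.1 (by simp [hc])
    have hc : c = a := by by_contra hc'; exact h.2 (by simp [hc'])
    exact hbc (hb.trans hc.symm)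

theorem IsVertexVector.exists_eq_single {n : Fin 3 → ℕ} {x : Fin 3 → ℤ} (h : IsVertexVector n x) :
    ∃ a, x = Pi.single a (x a) := by
  by_cases hx : ∃ a, x a ≠ 0
  · obtain ⟨a, ha⟩ := hx
    refine ⟨a, funext fun b => ?_⟩
    by_cases hb : b = a
    · subst hb; simp
    · rw [Pi.single_eq_of_ne hb]
      exact (h.2 b a hb).resolve_right ha
  · push Not at hx
    exact ⟨0, funext fun b => by rw [hx, hx, Pi.single_zero]; rfl⟩

/-- The coordinate vector of a divisor. -/
def coordVec {n : Fin 3 → ℕ} (D : Divisor (thetaGraph n)) : Fin 3 → ℤ := fun a => coord a D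

section CoordVec

variable {n : Fin 3 → ℕ}

@[simp] theorem coordVec_add (D E : Divisor (thetaGraph n)) :
    coordVec (D + E) = coordVec D + coordVec E := funext fun a => map_add (coord a) D E

@[simp] theorem coordVec_sub (D E : Divisor (thetaGraph n)) :
    coordVec (D - E) = coordVec D - coordVec E := funext fun a => map_sub (coord a) D E

@[simp] theorem coordVec_zsmul (m : ℤ) (D : Divisor (thetaGraph n)) :
    coordVec (m • D) = m • coordVec D := funext fun a => map_zsmul (coord a) m D

@[simp] theorem coordVec_zero : coordVec (0 : Divisor (thetaGraph n)) = 0 :=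
  funext fun a => map_zero (coord a)

theorem divClass_eq_iff_coordEquiv (hn : ∀ a, 1 ≤ n a) {D E : Divisor (thetaGraph n)}
    (h : degree D = degree E) :
    divClass D = divClass E ↔ CoordEquiv n (coordVec D) (coordVec E) := by
  rw [divClass_eq_iff_coord hn]
  exact and_iff_right h

theorem coordVec_thetaVertex {a : Fin 3} {i : ℕ} (hi : i < n a) :
    coordVec (chip (thetaVertex n a i)) = Pi.single a (i : ℤ) := by
  funext b
  rw [coordVec, coord_chip, thetaPos_thetaVertex hi, Pi.single_apply]

theorem coordVec_end (hn : ∀ a, 1 ≤ n a) (a : Fin 3) :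
    coordVec (chip (thetaVertex n a (n a))) = Pi.single 0 (n 0 : ℤ) := by
  funext b
  rw [coordVec, coord_chip, thetaPos_end hn, Pi.single_apply]

theorem coordEquiv_thetaVertex (hn : ∀ a, 1 ≤ n a) {a : Fin 3} {i : ℕ} (hi : i ≤ n a) :
    CoordEquiv n (coordVec (chip (thetaVertex n a i))) (Pi.single a (i : ℤ)) := by
  rcases hi.eq_or_lt with rfl | hi
  · rw [coordVec_end hn]
    exact CoordEquiv.single n 0 a
  · rw [coordVec_thetaVertex hi]
    exact CoordEquiv.refl _

theorem isVertexVector_coordVec (hn : ∀ a, 1 ≤ n a) (w : V(thetaGraph n)) :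
    IsVertexVector n (coordVec (chip w)) := by
  rcases exists_eq_thetaVertex hn w with rfl | ⟨a, i, hi, rfl⟩
  · rw [coordVec_end hn]
    exact isVertexVector_single (by positivity) le_rfl
  · rw [coordVec_thetaVertex hi]
    exact isVertexVector_single (by positivity) (by exact_mod_cast hi.le)

theorem exists_chip_of_isVertexVector (hn : ∀ a, 1 ≤ n a) {x : Fin 3 → ℤ}
    (hx : IsVertexVector n x) : ∃ w : V(thetaGraph n), CoordEquiv n (coordVec (chip w)) x := by
  obtain ⟨a, ha⟩ := hx.exists_eq_single
  have h := hx.1 a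
  refine ⟨thetaVertex n a (x a).toNat, ?_⟩
  have := coordEquiv_thetaVertex hn (a := a) (i := (x a).toNat) (by omega)
  rwa [Int.toNat_of_nonneg h.1, ← ha] at this

theorem systemNonempty_iff_isVertexVector (hn : ∀ a, 1 ≤ n a) {D : Divisor (thetaGraph n)}
    (hD : degree D = 1) :
    SystemNonempty D ↔ ∃ x, IsVertexVector n x ∧ CoordEquiv n (coordVec D) x := by
  rw [systemNonempty_iff_of_degree_eq_one hD]
  constructor
  · rintro ⟨w, hw⟩
    exact ⟨_, isVertexVector_coordVec hn w, (divClass_eq_iff_coordEquiv hn (by simp [hD])).1 hw⟩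
  · rintro ⟨x, hx, hD'⟩
    obtain ⟨w, hw⟩ := exists_chip_of_isVertexVector hn hx
    exact ⟨w, (divClass_eq_iff_coordEquiv hn (by simp [hD])).2 (hD'.trans hw.symm)⟩

/-- The lattice move `n b ε_b - n a ε_a` changes the energy by a positive multiple of `y b - y a + n
a`, so at a minimum this number is nonnegative. -/
theorem exists_min_energy (hn : ∀ a, 1 ≤ n a) (x : Fin 3 → ℤ) :
    ∃ y, CoordEquiv n x y ∧ ∀ a b, y a - y b ≤ n a := by
  -- `Q` is `4 n₀ n₁ n₂ ∑ (y a - n a / 2)² / n a`.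
  let Q : (Fin 3 → ℤ) → ℤ := fun y => n 1 * n 2 * (2 * y 0 - n 0) ^ 2 +
    n 0 * n 2 * (2 * y 1 - n 1) ^ 2 + n 0 * n 1 * (2 * y 2 - n 2) ^ 2
  have hQ : ∀ y, 0 ≤ Q y := fun y => by positivity
  obtain ⟨y, hy, hmin⟩ := exists_minimalFor_of_wellFoundedLT
    (CoordEquiv n x) (fun y => (Q y).toNat) ⟨x, CoordEquiv.refl x⟩
  refine ⟨y, hy, fun a b => ?_⟩
  by_contra! hlt
  have hab : a ≠ b := by rintro rfl; simp at hlt; omega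
  set y' : Fin 3 → ℤ := y + (Pi.single b (n b : ℤ) - Pi.single a (n a : ℤ)) with hy'
  have hyy' : CoordEquiv n x y' := by
    have h1 : CoordEquiv n (Pi.single b (n b : ℤ) - Pi.single a (n a : ℤ)) 0 := by
      have := (CoordEquiv.single n b a).sub (CoordEquiv.refl (n := n) (Pi.single a (n a : ℤ)))
      simpa using this
    have := hy.add h1.symm
    simpa [hy'] using this
  have h0 : (0 : ℤ) < n 0 := by exact_mod_cast hn 0
  have h1 : (0 : ℤ) < n 1 := by exact_mod_cast hn 1
  have h2 : (0 : ℤ) < n 2 := by exact_mod_cast hn 2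
  have hQlt : Q y' < Q y := by
    have hdiff : Q y' - Q y = 8 * (n 0 * n 1 * n 2) * (y b - y a + n a) := by
      fin_cases a <;> fin_cases b <;> simp [Q, hy'] at hab ⊢ <;> ring
    have : 8 * ((n 0 : ℤ) * n 1 * n 2) * (y b - y a + n a) < 0 :=
      mul_neg_of_pos_of_neg (by positivity) (by omega)
    omega
  have : (Q y).toNat ≤ (Q y').toNat := hmin hyy' (Int.toNat_le_toNat hQlt.le)
  have := hQ y'
  omega

/-- Subtract the least entry of an energy minimizer along `(1,1,1)`: one coordinate becomes 0 and
the other two lie in `[0, n a]`, which is a sum of two vertex vectors. -/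
theorem systemNonempty_of_degree_two (hn : ∀ a, 1 ≤ n a) (D : Divisor (thetaGraph n))
    (hD : degree D = 2) : SystemNonempty D := by
  obtain ⟨y, hy, hle⟩ := exists_min_energy hn (coordVec D)
  obtain ⟨b, -, hb⟩ := Finset.exists_min_image Finset.univ y ⟨0, Finset.mem_univ _⟩
  have hbound : ∀ a, 0 ≤ y a - y b ∧ y a - y b ≤ n a := fun a =>
    ⟨by have := hb a (Finset.mem_univ a); omega, hle a b⟩
  have hz : CoordEquiv n (coordVec D) (fun a => y a - y b) := by
    obtain ⟨c, m, hm, h⟩ := hy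
    exact ⟨c + y b, m, hm, fun a => by have := h a; linarith⟩
  obtain ⟨w, hw⟩ := exists_chip_of_isVertexVector hn
    (isVertexVector_single (hbound (b + 1)).1 (hbound (b + 1)).2)
  obtain ⟨w', hw'⟩ := exists_chip_of_isVertexVector hn
    (isVertexVector_single (hbound (b + 2)).1 (hbound (b + 2)).2)
  refine ⟨chip w + chip w', add_nonneg (chip_nonneg w) (chip_nonneg w'), ?_⟩
  refine (divClass_eq_iff_coordEquiv hn (by simp [hD])).2 (hz.trans ?_)
  have := (hw.add hw').symm
  rw [coordVec_add]
  convert this using 1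
  funext a
  fin_cases a <;> fin_cases b <;> simp

end CoordVec

/-! ### Evenly marked theta graphs -/

/-- The strands `a, b` of a theta graph, with the third strand `c`, have lengths `k A` and `k B`;
the points at distances `t A` and `t B` on them divide them in the same ratio `t / k`, in lowest
terms. -/
structure IsEvenMarking (n : Fin 3 → ℕ) (a b c : Fin 3) (A B t k : ℕ) : Prop where
  hn : ∀ d, 1 ≤ n d
  hab : a ≠ b
  hac : a ≠ c
  hbc : b ≠ c
  length_a : n a = k * A
  length_b : n b = k * B
  pos : 0 < t
  lt : t < k
  coprime : Nat.Coprime k t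

namespace IsEvenMarking

variable {n : Fin 3 → ℕ} {a b c : Fin 3} {A B t k : ℕ}

theorem A_pos (h : IsEvenMarking n a b c A B t k) : (0 : ℤ) < A := by
  have := h.hn a
  rw [h.length_a] at this
  exact_mod_cast Nat.pos_of_mul_pos_left this

theorem B_pos (h : IsEvenMarking n a b c A B t k) : (0 : ℤ) < B := by
  have := h.hn b
  rw [h.length_b] at this
  exact_mod_cast Nat.pos_of_mul_pos_left this

theorem c_pos (h : IsEvenMarking n a b c A B t k) : (0 : ℤ) < n c := by exact_mod_cast h.hn c

theorem k_pos (h : IsEvenMarking n a b c A B t k) : (0 : ℤ) < k := by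
  have := h.lt
  omega

theorem cast_length_a (h : IsEvenMarking n a b c A B t k) : (n a : ℤ) = k * A := by
  rw [h.length_a]; push_cast; rfl

theorem cast_length_b (h : IsEvenMarking n a b c A B t k) : (n b : ℤ) = k * B := by
  rw [h.length_b]; push_cast; rfl

theorem eq_or (h : IsEvenMarking n a b c A B t k) (d : Fin 3) : d = a ∨ d = b ∨ d = c := by
  have := h.hab
  have := h.hac
  have := h.hbc
  omega

theorem sum_eq (h : IsEvenMarking n a b c A B t k) (f : Fin 3 → ℤ) :
    ∑ d, f d = f a + f b + f c := by
  have : (Finset.univ : Finset (Fin 3)) = {a, b, c} := by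
    ext d
    simpa using h.eq_or d
  rw [this, Finset.sum_insert (by simp [h.hab, h.hac]), Finset.sum_pair h.hbc, add_assoc]

theorem coordEquiv_iff (h : IsEvenMarking n a b c A B t k) {x y : Fin 3 → ℤ} :
    CoordEquiv n x y ↔ ∃ C p q r : ℤ, p + q + r = 0 ∧ x a - y a = C + k * A * p ∧
      x b - y b = C + k * B * q ∧ x c - y c = C + n c * r := by
  constructor
  · rintro ⟨C, m, hm, hx⟩
    refine ⟨C, m a, m b, m c, by rw [← h.sum_eq, hm], ?_, ?_, hx c⟩
    · rw [hx, h.cast_length_a]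
    · rw [hx, h.cast_length_b]
  · rintro ⟨C, p, q, r, hs, ha, hb, hc⟩
    have hba := h.hab.symm
    have hca := h.hac.symm
    have hcb := h.hbc.symm
    refine ⟨C, fun d => if d = a then p else if d = b then q else r, ?_, fun d => ?_⟩
    · rw [h.sum_eq]
      simp [hba, hca, hcb, hs]
    · rcases h.eq_or d with rfl | rfl | rfl
      · simp [ha, h.cast_length_a]
      · simp [hba, hb, h.cast_length_b]
      · simp [hca, hcb, hc]

theorem coordVec_left (h : IsEvenMarking n a b c A B t k) :
    coordVec (chip (thetaVertex n a (t * A))) = Pi.single a ((t : ℤ) * A) := by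
  have hA : 0 < A := by exact_mod_cast h.A_pos
  rw [coordVec_thetaVertex (by rw [h.length_a]; exact Nat.mul_lt_mul_of_pos_right h.lt hA)]
  push_cast
  rfl

theorem swap (h : IsEvenMarking n a b c A B t k) : IsEvenMarking n b a c B A t k :=
  ⟨h.hn, h.hab.symm, h.hbc, h.hac, h.length_b, h.length_a, h.pos, h.lt, h.coprime⟩

theorem coordVec_right (h : IsEvenMarking n a b c A B t k) :
    coordVec (chip (thetaVertex n b (t * B))) = Pi.single b ((t : ℤ) * B) :=
  h.swap.coordVec_left

theorem dvd_mul_add_iff (h : IsEvenMarking n a b c A B t k) (p m : ℤ) :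
    (k : ℤ) ∣ k * p + m * t ↔ (k : ℤ) ∣ m := by
  rw [Int.dvd_add_right (dvd_mul_right _ _)]
  exact ⟨fun hd => (Nat.isCoprime_iff_coprime.2 h.coprime).dvd_of_dvd_mul_right hd,
    fun hd => hd.mul_right _⟩

/-- Two points whose difference is equivalent to a multiple of the difference of the marked points
lie on the marked strands and differ from each other in the same ratio. -/
theorem exists_of_coordEquiv (h : IsEvenMarking n a b c A B t k) {x y : Fin 3 → ℤ}
    (hx : IsVertexVector n x) (hy : IsVertexVector n y) {m : ℤ} (hm : ¬ (k : ℤ) ∣ m)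
    (hxy : CoordEquiv n (y - x) (m • (Pi.single a ((t : ℤ) * A) - Pi.single b ((t : ℤ) * B)))) :
    ∃ p : ℤ, k * p + m * t ≠ 0 ∧ -k < k * p + m * t ∧ k * p + m * t < k ∧
      y a - x a = A * (k * p + m * t) ∧ y b - x b = -(B * (k * p + m * t)) ∧ y c - x c = 0 := by
  obtain ⟨C, p, q, r, hs, ha, hb, hc⟩ := h.coordEquiv_iff.1 hxy
  simp only [Pi.sub_apply, Pi.smul_apply, smul_eq_mul, Pi.single_eq_same,
    Pi.single_eq_of_ne h.hab, Pi.single_eq_of_ne h.hab.symm, Pi.single_eq_of_ne h.hac.symm,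
    Pi.single_eq_of_ne h.hbc.symm] at ha hb hc
  have hM : ¬ (k : ℤ) ∣ k * p + m * t := (h.dvd_mul_add_iff p m).not.2 hm
  have xa := hx.1 a
  have xb := hx.1 b
  have xc := hx.1 c
  have ya := hy.1 a
  have yb := hy.1 b
  have yc := hy.1 c
  rw [h.cast_length_a] at xa ya
  rw [h.cast_length_b] at xb yb
  have xab := hx.2 a b h.hab
  have xac := hx.2 a c h.hac
  have xbc := hx.2 b c h.hbc
  have yab := hy.2 a b h.hab
  have yac := hy.2 a c h.hac
  have ybc := hy.2 b c h.hbc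
  have hM' : k * q - m * t = -(k * p + m * t) - k * r := by
    have : q = -p - r := by omega
    rw [this]; ring
  -- The multiple of `u - v` is absorbed into the lattice coefficients: `y a - x a = C + A (k p + m
  -- t)` and `y b - x b = C + B (k q - m t)`.
  obtain ⟨rfl, rfl, h1, h2⟩ := eq_zero_of_balanced (A := A) (B := B) (N := n c) (k := k) (C := C)
    (M := k * p + m * t) (M' := k * q - m * t) (g := r) (X := y a - x a) (Y := y b - x b)
    (Z := y c - x c) h.A_pos h.B_pos h.c_pos (by linarith) (by linarith) (by linarith)
    (by rw [hM']; ring) h.k_pos hM (by omega) (by omega) (by omega) (by omega) (by omega)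
    (by omega) (by omega) (by omega) (by omega) (by omega) (by omega) (by omega)
  refine ⟨p, ?_, h1, h2, by linarith, ?_, by linarith⟩
  · intro h0
    exact hM (h0 ▸ dvd_zero _)
  · have : q = -p := by omega
    subst this
    linarith

theorem zsmul_eq_zero_iff (h : IsEvenMarking n a b c A B t k) (m : ℤ) :
    m • (divClass (chip (thetaVertex n a (t * A))) - divClass (chip (thetaVertex n b (t * B)))) = 0 ↔
      (k : ℤ) ∣ m := by
  change divClass (m • (chip (thetaVertex n a (t * A)) - chip (thetaVertex n b (t * B)))) =
    divClass 0 ↔ _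
  rw [divClass_eq_iff_coordEquiv h.hn
    (by rw [degree_zsmul, degree_sub, degree_chip, degree_chip, degree_zero]; ring),
    h.coordEquiv_iff]
  simp only [coordVec_zsmul, coordVec_sub, h.coordVec_left, h.coordVec_right, coordVec_zero,
    Pi.sub_apply, Pi.smul_apply, smul_eq_mul, Pi.single_eq_same, Pi.zero_apply,
    Pi.single_eq_of_ne h.hab, Pi.single_eq_of_ne h.hab.symm, Pi.single_eq_of_ne h.hac.symm,
    Pi.single_eq_of_ne h.hbc.symm]
  have hA := h.A_pos
  have hB := h.B_pos
  have hN := h.c_pos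
  have hk := h.k_pos
  constructor
  · rintro ⟨C, p, q, r, hs, ha, hb, hc⟩
    have hpq : p + q = -r := by omega
    -- Eliminating `C`, `p` and `q` leaves `r` times a positive number.
    have e : r * (n c * (A + B) + k * A * B) = 0 := by
      have : C = -(n c * r) := by linarith
      subst this
      linear_combination (B : ℤ) * ha + A * hb + k * A * B * hpq
    have hr : r = 0 := (mul_eq_zero.1 e).resolve_right (by positivity)
    subst hr
    have hC : C = 0 := by linarith
    subst hC
    have : k * (-p) + m * t = 0 :=
      (mul_eq_zero.1 (show (A : ℤ) * (k * (-p) + m * t) = 0 by linarith)).resolve_left hA.ne'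
    exact (h.dvd_mul_add_iff (-p) m).1 (this ▸ dvd_zero _)
  · rintro ⟨s, rfl⟩
    exact ⟨0, s * t, -(s * t), 0, by ring, by ring, by ring, by ring⟩

/-- With `M = k p + m t ≠ 0`, a point `x` with `x a ≠ 0` must move to strand `b`, so `x a = -A M`;
with `x a = 0` it must move to strand `a`, so `x b = B M`. Either way `x` determines `M`, hence `m`
modulo `k`. -/
theorem dvd_of_three (h : IsEvenMarking n a b c A B t k) (D : Divisor (thetaGraph n))
    (hD : degree D = 1) (m m' : ℤ) (h0 : SystemNonempty D)
    (h1 : SystemNonempty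
      (D + m • (chip (thetaVertex n a (t * A)) - chip (thetaVertex n b (t * B)))))
    (h2 : SystemNonempty
      (D + m' • (chip (thetaVertex n a (t * A)) - chip (thetaVertex n b (t * B))))) :
    (k : ℤ) ∣ m ∨ (k : ℤ) ∣ m' ∨ (k : ℤ) ∣ m - m' := by
  by_contra! hc
  obtain ⟨hm, hm', hmm⟩ := hc
  obtain ⟨x, hx, hDx⟩ := (systemNonempty_iff_isVertexVector h.hn hD).1 h0
  have key : ∀ m : ℤ, ¬ (k : ℤ) ∣ m → SystemNonempty
      (D + m • (chip (thetaVertex n a (t * A)) - chip (thetaVertex n b (t * B)))) →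
      ∃ p : ℤ, (x a ≠ 0 → x a = -(A * (k * p + m * t))) ∧ (x a = 0 → x b = B * (k * p + m * t)) :=
    fun m hm h1 => by
      obtain ⟨y, hy, hDy⟩ := (systemNonempty_iff_isVertexVector h.hn
        (by rw [degree_add, degree_zsmul, degree_sub, degree_chip, degree_chip, hD]; ring)).1 h1
      have hxy := (hDy.sub hDx).symm
      rw [coordVec_add, add_sub_cancel_left, coordVec_zsmul, coordVec_sub, h.coordVec_left,
        h.coordVec_right] at hxy
      obtain ⟨p, hp, -, -, ha, hb, -⟩ := h.exists_of_coordEquiv hx hy hm hxy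
      refine ⟨p, fun hxa => ?_, fun hxa => ?_⟩
      · have hxb := (hx.2 a b h.hab).resolve_left hxa
        have hyb : y b ≠ 0 := by
          rw [hxb, sub_zero] at hb
          rw [hb, neg_ne_zero]
          exact mul_ne_zero h.B_pos.ne' hp
        have hya := (hy.2 a b h.hab).resolve_right hyb
        linarith
      · have hya : y a ≠ 0 := by
          rw [hxa, sub_zero] at ha
          rw [ha]
          exact mul_ne_zero h.A_pos.ne' hp
        have hyb := (hy.2 a b h.hab).resolve_left hya
        linarith
  obtain ⟨p, hp, hp'⟩ := key m hm h1
  obtain ⟨q, hq, hq'⟩ := key m' hm' h2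
  have heq : (k : ℤ) * p + m * t = k * q + m' * t := by
    by_cases hxa : x a = 0
    · exact mul_left_cancel₀ h.B_pos.ne' ((hp' hxa).symm.trans (hq' hxa))
    · exact mul_left_cancel₀ h.A_pos.ne' (neg_injective ((hp hxa).symm.trans (hq hxa)))
  apply hmm
  rw [← h.dvd_mul_add_iff (p - q)]
  have : (k : ℤ) * (p - q) + (m - m') * t = 0 := by linear_combination heq
  exact this ▸ dvd_zero _

/-- The canonical divisor of a theta graph. -/
noncomputable def canonical (n : Fin 3 → ℕ) : Divisor (thetaGraph n) :=
  chip (thetaVertex n 0 0) + chip (thetaVertex n 0 (n 0))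

theorem degree_canonical (n : Fin 3 → ℕ) : degree (canonical n) = 2 := by
  rw [canonical, degree_add, degree_chip, degree_chip]; norm_num

theorem coordEquiv_canonical (hn : ∀ a, 1 ≤ n a) (a : Fin 3) :
    CoordEquiv n (coordVec (canonical n)) (Pi.single a (n a : ℤ)) := by
  rw [canonical, coordVec_add, coordVec_thetaVertex (hn 0), coordVec_end hn, Nat.cast_zero,
    Pi.single_zero, zero_add]
  exact CoordEquiv.single n 0 a

/-- `K ∼ n a ε_a` for every strand `a`, so `K` minus a point of strand `a` is the reflected point of
that strand. -/
theorem nonempty_canonical_sub (hn : ∀ a, 1 ≤ n a) (w : V(thetaGraph n)) :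
    SystemNonempty (canonical n - chip w) := by
  rw [systemNonempty_iff_isVertexVector hn (by
    rw [degree_sub, degree_canonical, degree_chip]; norm_num)]
  have hw := isVertexVector_coordVec hn w
  obtain ⟨a, ha⟩ := hw.exists_eq_single
  have hwa := hw.1 a
  refine ⟨Pi.single a (n a - coordVec (chip w) a),
    isVertexVector_single (by omega) (by omega), ?_⟩
  rw [coordVec_sub, Pi.single_sub, ← ha]
  exact (coordEquiv_canonical hn a).sub (CoordEquiv.refl _)

/-- This one fact separates `u + v` from `K`, because `K` minus any vertex is effective. -/
theorem not_nonempty_sub_corner (h : IsEvenMarking n a b c A B t k) :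
    ¬ SystemNonempty (chip (thetaVertex n a (t * A)) + chip (thetaVertex n b (t * B)) -
      chip (thetaVertex n 0 0)) := by
  rw [systemNonempty_iff_isVertexVector h.hn (by simp)]
  rintro ⟨x, hx, hxe⟩
  rw [coordVec_sub, coordVec_add, h.coordVec_left, h.coordVec_right,
    coordVec_thetaVertex (h.hn 0), Nat.cast_zero, Pi.single_zero, sub_zero,
    h.coordEquiv_iff] at hxe
  obtain ⟨C, p, q, r, hs, ha, hb, hc⟩ := hxe
  simp only [Pi.add_apply, Pi.single_eq_same, Pi.single_eq_of_ne h.hab,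
    Pi.single_eq_of_ne h.hab.symm, Pi.single_eq_of_ne h.hac.symm,
    Pi.single_eq_of_ne h.hbc.symm, add_zero, zero_add, zero_sub] at ha hb hc
  have xa := hx.1 a
  have xb := hx.1 b
  have xc := hx.1 c
  rw [h.cast_length_a] at xa
  rw [h.cast_length_b] at xb
  exact not_balanced_of_corner h.A_pos h.B_pos h.c_pos (by exact_mod_cast h.pos)
    (by exact_mod_cast h.lt) ha hb hc hs xa.1 xb.1 xc.1 xa.2 xb.2 xc.2 (hx.2 a b h.hab)

theorem two_le (h : IsEvenMarking n a b c A B t k) : 2 ≤ k := by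
  have := h.pos
  have := h.lt
  omega

/-- If `D - u ∼ x` and `D - v ∼ y`, then `y - x ∼ u - v`, and `-k < k p + t < k` leaves two values
of `p`. -/
theorem eq_canonical_or (h : IsEvenMarking n a b c A B t k) (D : Divisor (thetaGraph n))
    (hD : degree D = 2) (hu : SystemNonempty (D - chip (thetaVertex n a (t * A))))
    (hv : SystemNonempty (D - chip (thetaVertex n b (t * B)))) :
    divClass D = divClass (canonical n) ∨ divClass D =
      divClass (chip (thetaVertex n a (t * A))) + divClass (chip (thetaVertex n b (t * B))) := by
  rw [← divClass_add, divClass_eq_iff_coordEquiv h.hn (hD.trans (degree_canonical n).symm),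
    divClass_eq_iff_coordEquiv h.hn (by simp [hD])]
  rw [systemNonempty_iff_isVertexVector h.hn (by simp [hD])] at hu hv
  obtain ⟨x, hx, hxe⟩ := hu
  obtain ⟨y, hy, hye⟩ := hv
  rw [coordVec_sub, h.coordVec_left] at hxe
  rw [coordVec_sub, h.coordVec_right] at hye
  rw [coordVec_add, h.coordVec_left, h.coordVec_right]
  have hDx : CoordEquiv n (coordVec D) (Pi.single a ((t : ℤ) * A) + x) := by
    have := hxe.add (CoordEquiv.refl (n := n) (Pi.single a ((t : ℤ) * A)))
    rwa [sub_add_cancel, add_comm x] at this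
  have hxy : CoordEquiv n (y - x)
      ((1 : ℤ) • (Pi.single a ((t : ℤ) * A) - Pi.single b ((t : ℤ) * B))) := by
    have := (hye.sub hxe).symm
    rw [sub_sub_sub_cancel_left] at this
    rwa [one_smul]
  have hk1 : ¬ (k : ℤ) ∣ 1 := fun hd => by
    have := Int.le_of_dvd one_pos hd
    have := h.two_le
    omega
  obtain ⟨p, hp, hl, hr, ha, hb, hc⟩ := h.exists_of_coordEquiv hx hy hk1 hxy
  have hA := h.A_pos
  have hB := h.B_pos
  have hk := h.k_pos
  have ht : (0 : ℤ) < t := by exact_mod_cast h.pos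
  have htk : (t : ℤ) < k := by exact_mod_cast h.lt
  have hp0 : p < 1 := lt_of_mul_lt_mul_left (a := (k : ℤ)) (by linarith) hk.le
  have hp1 : -2 < p := lt_of_mul_lt_mul_left (a := (k : ℤ)) (by linarith) hk.le
  have xa := hx.1 a
  have xb := hx.1 b
  have ya := hy.1 a
  have yb := hy.1 b
  have xab := hx.2 a b h.hab
  have yab := hy.2 a b h.hab
  -- For `p = -1`, `x` is the reflection of `u` in its strand and `D ∼ K`; for `p = 0`, `x` is `v`
  -- itself.
  obtain rfl | rfl : p = -1 ∨ p = 0 := by omega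
  · left
    have hM : (k : ℤ) * -1 + 1 * t < 0 := by linarith
    have h1 := mul_neg_of_pos_of_neg hA hM
    have h2 := mul_neg_of_pos_of_neg hB hM
    have hxa : x = Pi.single a (x a) := by
      obtain ⟨d, hd⟩ := hx.exists_eq_single
      have : a = d := by
        by_contra hne
        rw [hd, Pi.single_eq_of_ne hne] at ha
        omega
      exact this ▸ hd
    have hya : y a = 0 := yab.resolve_right (by omega)
    have hsum : (t : ℤ) * A + x a = n a := by
      rw [h.cast_length_a]
      linear_combination hya - ha
    rw [hxa, ← Pi.single_add, hsum] at hDx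
    exact hDx.trans (coordEquiv_canonical h.hn a).symm
  · right
    have hM : 0 < (k : ℤ) * 0 + 1 * t := by linarith
    have h1 := mul_pos hA hM
    have h2 := mul_pos hB hM
    have hxb : x = Pi.single b (x b) := by
      obtain ⟨d, hd⟩ := hx.exists_eq_single
      have : b = d := by
        by_contra hne
        rw [hd, Pi.single_eq_of_ne hne] at hb
        omega
      exact this ▸ hd
    have hyb : y b = 0 := yab.resolve_left (by omega)
    have hxv : x b = (t : ℤ) * B := by linear_combination hyb - hb
    rwa [hxb, hxv] at hDx

theorem isGenusTwoMarking (h : IsEvenMarking n a b c A B t k) :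
    IsGenusTwoMarking (thetaVertex n a (t * A)) (thetaVertex n b (t * B)) (canonical n) k where
  degree_canonical := degree_canonical n
  nonempty_of_degree_two := systemNonempty_of_degree_two h.hn
  nonempty_canonical_sub := nonempty_canonical_sub h.hn
  eq_canonical D hD hw := by
    -- The vertices `u` and `v` reduce to two classes, and the trivalent vertex rules out `u + v`.
    refine (h.eq_canonical_or D hD (hw _) (hw _)).resolve_right fun hc => ?_
    exact h.not_nonempty_sub_corner ((hw (thetaVertex n 0 0)).of_divClass_eq (by simp [hc]))
  eq_canonical_or := h.eq_canonical_or
  add_ne_canonical hc := h.not_nonempty_sub_corner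
    ((nonempty_canonical_sub h.hn (thetaVertex n 0 0)).of_divClass_eq (by simp [hc]))
  two_le := h.two_le
  zsmul_eq_zero_iff := h.zsmul_eq_zero_iff
  dvd_of_three := h.dvd_of_three

end IsEvenMarking

/-! ### Reduction of the common ratio to lowest terms -/

theorem EvenlyMarked.exists_isEvenMarking {n : Fin 3 → ℕ} (hn : ∀ a, 1 ≤ n a) {a b : Fin 3}
    {i j : ℕ} (h : EvenlyMarked n a i b j) :
    ∃ c A B t k, IsEvenMarking n a b c A B t k ∧ i = t * A ∧ j = t * B ∧
      n a / Nat.gcd (n a) i = k ∧ n b / Nat.gcd (n b) j = k := by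
  obtain ⟨c, hac, hbc⟩ : ∃ c : Fin 3, a ≠ c ∧ b ≠ c := by
    have : ∀ a b : Fin 3, ∃ c : Fin 3, a ≠ c ∧ b ≠ c := by decide
    exact this a b
  have ha := hn a
  have hb := hn b
  have hcross : i * n b = j * n a := by
    have := h.ratio_eq
    rw [div_eq_div_iff (by positivity) (by positivity)] at this
    exact_mod_cast this
  have hg : 0 < Nat.gcd (n a) i := Nat.gcd_pos_of_pos_left _ ha
  obtain ⟨k, hk⟩ := Nat.gcd_dvd_left (n a) i
  obtain ⟨t, ht⟩ := Nat.gcd_dvd_right (n a) i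
  set A := Nat.gcd (n a) i with hA
  have hcop : Nat.Coprime k t := by
    have := Nat.coprime_div_gcd_div_gcd (m := n a) (n := i) hg
    rwa [← hA, Nat.div_eq_of_eq_mul_right hg hk, Nat.div_eq_of_eq_mul_right hg ht] at this
  have hcross' : t * n b = j * k := by
    apply Nat.eq_of_mul_eq_mul_left hg
    calc A * (t * n b) = A * t * n b := by ring
      _ = j * (A * k) := by rw [← ht, ← hk, hcross]
      _ = A * (j * k) := by ring
  -- The equal ratios give `t * n b = j * k`, and `k` is prime to `t`.
  obtain ⟨B, hB⟩ : k ∣ n b := hcop.dvd_of_dvd_mul_left ⟨j, by rw [hcross', mul_comm]⟩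
  have hkpos : 0 < k := Nat.pos_of_ne_zero fun h0 => by rw [h0, mul_zero] at hk; omega
  have hBpos : 0 < B := Nat.pos_of_ne_zero fun h0 => by rw [h0, mul_zero] at hB; omega
  have hj : j = t * B := by
    apply Nat.eq_of_mul_eq_mul_right hkpos
    rw [← hcross', hB]; ring
  have hi : i = t * A := by rw [mul_comm]; exact ht
  have htpos : 0 < t := Nat.pos_of_ne_zero fun h0 => by
    have := h.pos
    rw [hi, h0, zero_mul] at this
    omega
  have htk : t < k := by
    have := h.lt
    rw [hk, ht] at this
    exact Nat.lt_of_mul_lt_mul_left this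
  refine ⟨c, A, B, t, k, ⟨hn, h.strand_ne, hac, hbc, by rw [mul_comm]; exact hk, hB, htpos, htk,
    hcop⟩, hi, hj, Nat.div_eq_of_eq_mul_right hg hk, ?_⟩
  rw [hj, hB, Nat.gcd_mul_right, hcop.gcd_eq_one, one_mul, Nat.mul_div_cancel _ hBpos]

end ChipFiring

theorem mainTheorem7 (n : Fin 3 → ℕ) (hn : ∀ a, 1 ≤ n a) (a b : Fin 3) (i j : ℕ)
    (h : ChipFiring.EvenlyMarked n a i b j) :
    n a / Nat.gcd (n a) i = n b / Nat.gcd (n b) j ∧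
    ChipFiring.HasGeneralTransmission (ChipFiring.thetaGraph n)
      (ChipFiring.thetaVertex n a i) (ChipFiring.thetaVertex n b j) (n a / Nat.gcd (n a) i) ∧
    addOrderOf (ChipFiring.divClass
      (ChipFiring.chip (ChipFiring.thetaVertex n a i) -
        ChipFiring.chip (ChipFiring.thetaVertex n b j))) = n a / Nat.gcd (n a) i ∧
    ChipFiring.NonRecurrent
      (ChipFiring.chip (ChipFiring.thetaVertex n a i) -
        ChipFiring.chip (ChipFiring.thetaVertex n b j)) := by
  obtain ⟨c, A, B, t, k, hm, hi, hj, hka, hkb⟩ := h.exists_isEvenMarking hn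
  rw [hka, hkb, hi, hj]
  have h2 := hm.isGenusTwoMarking
  exact ⟨rfl, h2.hasGeneralTransmission (ChipFiring.genus_thetaGraph n hn), h2.addOrderOf_eq,
    h2.nonRecurrent⟩
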